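/- **Tropical Abel–Jacobi theorem.** Let $C$ be a compact tropical curve, that is, a connected finite metric graph (not a single point) whose inner edges have finite positive length and whose leaves (the edges adjacent to 1-valent vertices) have infinite length, the 1-valent vertices being points at infinity that belong to $C$. Write $C^\circ$ for the complement of the 1-valent vertices. Rational functions on an open set $U\subset C$ are the continuous functions $U\cap C^\circ\to\mathbb R$ that are locally piecewise affine with finitely many pieces and integer slopes; the order $\operatorname{ord}_p f$ of $f$ at $p\in U$ is the sum of its slopes along the outward primitive tangent vectors at $p$ (at a point at infinity: its eventual slope along the leaf in the direction away from $p$). Let $\mathcal O^*$ be the sheaf of rational functions with order $0$ at every point (affine functions). A line bundle on $C$ is an $\mathcal O^*$-torsor, so that isomorphism classes of line bundles form $\operatorname{Pic}(C)=H^1(C,\mathcal O^*)$. A divisor $D=\sum a_ip_i$ ($a_i\in\mathbb Z$, $p_i\in C$, a finite sum) has degree $\sum a_i$ and defines a line bundle $L(D)$, which has a rational section with divisor $D$. For $d\in\mathbb Z$ let $\operatorname{Div}^d(C)$ be the set of divisors of degree $d$, and let $\operatorname{Pic}^d(C)$ be the set of isomorphism classes of line bundles of degree $d$, i.e. of those having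 a rational section whose divisor has degree $d$. Let $\Omega(C)$ be the real vector space of 1-forms on $C$: a form has a constant value on the primitive tangent vector of each oriented edge, changes sign with the orientation, and at each point of $C$ its values on the outward primitive tangent vectors add up to $0$. Integration embeds $H_1(C,\mathbb Z)$ into $\Omega(C)^*$, and $J(C)=\Omega(C)^*/H_1(C,\mathbb Z)$. Fix $p_0\in C$. Then for every $d\in\mathbb Z$ the class in $J(C)$ of the functional $\omega\mapsto\sum a_i\int_{p_0}^{p_i}\omega$ does not depend on the paths of integration from $p_0$ to $p_i$, and so defines the Abel–Jacobi map $\mu:\operatorname{Div}^d(C)\to J(C)$, $\sum a_ip_i\mapsto\big[\sum a_i\int_{p_0}^{p_i}\big]$. This map factors through $\operatorname{Pic}^d(C)$: there is a map $\phi:\operatorname{Pic}^d(C)\to J(C)$ with $\mu(D)=\phi([L(D)])$ for all $D\in\operatorname{Div}^d(C)$, and $\phi$ is a bijection. -/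

import Mathlib

open Filter Topology

universe u

/-- A compact tropical curve, given as a connected finite metric graph: finite (non-1-valent)
vertices `V`, inner edges `E` of finite positive length (loops and multiple edges are allowed), and
leaves `L`, each of them a copy of `[0, ∞]` whose point `0` is glued to the vertex `root l` and whose
point `∞` is a 1-valent vertex (an endpoint) of the curve.  Every vertex in `V` has valence at
least two: the 1-valent vertices are exactly the points at infinity of the leaves, and the curve is
not a single point.  (The curve `[-∞, ∞]` is a 2-valent vertex with two leaves.) -/
structure TropicalCurve where
  V : Type u
  E : Type u
  L : Type u
  [fintypeV : Fintype V]
  [fintypeE : Fintype E]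
  [fintypeL : Fintype L]
  src : E → V
  tgt : E → V
  root : L → V
  len : E → ℝ
  len_pos : ∀ e, 0 < len e
  nonempty : Nonempty V
  connected : ∀ v w : V, Relation.EqvGen (fun a b => ∃ e, src e = a ∧ tgt e = b) v w
  two_le_valence : ∀ v : V, 2 ≤ Nat.card {e // src e = v} + Nat.card {e // tgt e = v} +
    Nat.card {l // root l = v}

noncomputable section

namespace TropicalCurve

attribute [instance] fintypeV fintypeE fintypeL

variable (G : TropicalCurve.{u})

/-! ### Points, tangent directions, topology -/

/-- Points of the finite part of the curve. -/
inductive FinPoint : Type u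
  | vertex (v : G.V) : FinPoint
  | edge (e : G.E) (t : ℝ) (h₀ : 0 < t) (h₁ : t < G.len e) : FinPoint
  | leaf (l : G.L) (t : ℝ) (h₀ : 0 < t) : FinPoint

/-- Points of the compact curve: finite points, and one endpoint at infinity for each leaf. -/
inductive Point : Type u
  | fin (x : G.FinPoint) : Point
  | infty (l : G.L) : Point

/-- Oriented edges and leaves. The orientation `true` goes from `src e` to `tgt e`,
respectively from `root l` to infinity. -/
abbrev Dir : Type u := (G.E × Bool) ⊕ (G.L × Bool)

variable {G}

/-- The point with coordinate `t ∈ [0, len e]` on the edge `e`. -/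
def edgePt (e : G.E) (t : ℝ) : G.FinPoint :=
  if h₀ : 0 < t then
    if h₁ : t < G.len e then FinPoint.edge e t h₀ h₁ else FinPoint.vertex (G.tgt e)
  else FinPoint.vertex (G.src e)

/-- The point with coordinate `t ∈ [0, ∞)` on the leaf `l`. -/
def leafPt (l : G.L) (t : ℝ) : G.FinPoint :=
  if h₀ : 0 < t then FinPoint.leaf l t h₀ else FinPoint.vertex (G.root l)

/-- `IsTangent p τ`: the oriented edge or leaf `τ` is (the direction of) an outward primitive
tangent vector at `p`. -/
def IsTangent : G.Point → G.Dir → Prop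
  | .fin (.vertex v), .inl (e, true) => G.src e = v
  | .fin (.vertex v), .inl (e, false) => G.tgt e = v
  | .fin (.vertex v), .inr (l, true) => G.root l = v
  | .fin (.vertex _), .inr (_, false) => False
  | .fin (.edge e _ _ _), .inl (e', _) => e' = e
  | .fin (.edge _ _ _ _), .inr _ => False
  | .fin (.leaf l _ _), .inr (l', _) => l' = l
  | .fin (.leaf _ _ _), .inl _ => False
  | .infty l, .inr (l', false) => l' = l
  | .infty _, .inr (_, true) => False
  | .infty _, .inl _ => False

open Classical in
/-- The finite set of outward primitive tangent vectors at `p`; its cardinality is the valence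
of `p`. -/
def tangents (p : G.Point) : Finset G.Dir := Finset.univ.filter (IsTangent p)

/-- The point at (small) distance `s` from the finite point `x` in the tangent direction `τ`. -/
def step : G.FinPoint → G.Dir → ℝ → G.FinPoint
  | .vertex _, .inl (e, true), s => edgePt e s
  | .vertex _, .inl (e, false), s => edgePt e (G.len e - s)
  | .vertex _, .inr (l, _), s => leafPt l s
  | .edge e t _ _, .inl (_, true), s => edgePt e (t + s)
  | .edge e t _ _, .inl (_, false), s => edgePt e (t - s)
  | .edge e t h₀ h₁, .inr _, _ => .edge e t h₀ h₁
  | .leaf l t _, .inr (_, true), s => leafPt l (t + s)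
  | .leaf l t _, .inr (_, false), s => leafPt l (t - s)
  | .leaf l t h₀, .inl _, _ => .leaf l t h₀

/-- The filter of points tending to `p` along the outward tangent direction `τ`. -/
def germ : G.Point → G.Dir → Filter G.FinPoint
  | .fin x, τ => map (step x τ) (𝓝[>] (0 : ℝ))
  | .infty l, _ => map (leafPt l) atTop

/-- The topology of the compact curve: a set is open if with each of its points it contains a
small interval in each tangent direction at that point. -/
instance : TopologicalSpace G.Point where
  IsOpen U := ∀ p ∈ U, ∀ τ ∈ tangents p, ∀ᶠ y in germ p τ, Point.fin y ∈ U
  isOpen_univ := fun _ _ _ _ => Eventually.of_forall fun _ => trivial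
  isOpen_inter := fun _ _ hU hW p hp τ hτ => (hU p hp.1 τ hτ).and (hW p hp.2 τ hτ)
  isOpen_sUnion := fun _ h p ⟨U, hU, hp⟩ τ hτ =>
    (h U hU p hp τ hτ).mono fun _ hy => ⟨U, hU, hy⟩

theorem isOpen_def {U : Set G.Point} :
    IsOpen U ↔ ∀ p ∈ U, ∀ τ ∈ tangents p, ∀ᶠ y in germ p τ, Point.fin y ∈ U := Iff.rfl

/-! ### Rational and affine functions, divisors -/

/-- `f` is affine near `p` along the outward tangent direction `τ`, with integral slope `m`
(the derivative is taken along the primitive vector pointing away from `p`). Functions are real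
valued on the finite part. At an endpoint at infinity this says `f = c - m * t` for large `t`,
where `t` is the coordinate on the leaf, which grows towards the endpoint. -/
def HasSlope (f : G.FinPoint → ℝ) : G.Point → G.Dir → ℤ → Prop
  | .fin x, τ, m => ∀ᶠ s in 𝓝[>] (0 : ℝ), f (step x τ s) = f x + m * s
  | .infty l, _, m => ∃ c : ℝ, ∀ᶠ t in atTop, f (leafPt l t) = c - m * t

open Classical in
/-- The derivative of `f` at `p` along the outward primitive tangent vector `τ`. -/
def slope (f : G.FinPoint → ℝ) (p : G.Point) (τ : G.Dir) : ℤ :=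
  if h : ∃ m, HasSlope f p τ m then h.choose else 0

/-- The order of `f` at `p`: the sum of its outward slopes. -/
def ord (f : G.FinPoint → ℝ) (p : G.Point) : ℤ := ∑ τ ∈ tangents p, slope f p τ

/-- `f` is a rational function on `U`: continuous and piecewise affine with integral slopes,
locally with finitely many pieces. Only the values of `f` on the finite part of `U` matter. -/
def RationalOn (f : G.FinPoint → ℝ) (U : Set G.Point) : Prop :=
  ∀ p ∈ U, ∀ τ ∈ tangents p, ∃ m, HasSlope f p τ m

/-- `f` is a section of the sheaf `𝒪*` over `U`: an affine function with integral slopes, which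
means that moreover the outward slopes add up to zero at each point of `U`. -/
def AffineOn (f : G.FinPoint → ℝ) (U : Set G.Point) : Prop :=
  RationalOn f U ∧ ∀ p ∈ U, ord f p = 0

variable (G) in
/-- Divisors on the curve. -/
abbrev Divisor : Type u := G.Point →₀ ℤ

/-- The degree of a divisor. -/
def Divisor.deg (D : G.Divisor) : ℤ := D.sum fun _ n => n

variable (G) in
/-- Divisors of degree `d`. -/
def DivDeg (d : ℤ) : Type u := {D : G.Divisor // D.deg = d}

/-! ### Basic facts on slopes -/

theorem HasSlope.unique {f : G.FinPoint → ℝ} {p : G.Point} {τ : G.Dir} {m n : ℤ}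
    (hm : HasSlope f p τ m) (hn : HasSlope f p τ n) : m = n := by
  cases p with
  | fin x =>
    obtain ⟨s, ⟨h1, h2⟩, hs⟩ := ((Eventually.and hm hn).and self_mem_nhdsWithin).exists
    have hs : (0 : ℝ) < s := hs
    have : (m : ℝ) * s = n * s := by linarith
    exact_mod_cast mul_right_cancel₀ hs.ne' this
  | infty l =>
    obtain ⟨c, hc⟩ := hm
    obtain ⟨c', hc'⟩ := hn
    obtain ⟨N, hN⟩ := eventually_atTop.1 (hc.and hc')
    have h1 := hN N le_rfl
    have h2 := hN (N + 1) (by linarith)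
    have : (m : ℝ) = n := by linarith [h1.1, h1.2, h2.1, h2.2]
    exact_mod_cast this

theorem HasSlope.slope_eq {f : G.FinPoint → ℝ} {p : G.Point} {τ : G.Dir} {m : ℤ}
    (hm : HasSlope f p τ m) : slope f p τ = m := by
  have h : ∃ m, HasSlope f p τ m := ⟨m, hm⟩
  rw [slope, dif_pos h]
  exact h.choose_spec.unique hm

theorem HasSlope.add {f g : G.FinPoint → ℝ} {p : G.Point} {τ : G.Dir} {m n : ℤ}
    (hm : HasSlope f p τ m) (hn : HasSlope g p τ n) :
    HasSlope (fun x => f x + g x) p τ (m + n) := by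
  cases p with
  | fin x =>
    filter_upwards [hm, hn] with s h1 h2
    rw [h1, h2]; push_cast; ring
  | infty l =>
    obtain ⟨c, hc⟩ := hm
    obtain ⟨c', hc'⟩ := hn
    refine ⟨c + c', ?_⟩
    filter_upwards [hc, hc'] with s h1 h2
    rw [h1, h2]; push_cast; ring

theorem HasSlope.neg {f : G.FinPoint → ℝ} {p : G.Point} {τ : G.Dir} {m : ℤ}
    (hm : HasSlope f p τ m) : HasSlope (fun x => - f x) p τ (-m) := by
  cases p with
  | fin x =>
    filter_upwards [hm] with s h1
    rw [h1]; push_cast; ring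
  | infty l =>
    obtain ⟨c, hc⟩ := hm
    refine ⟨-c, ?_⟩
    filter_upwards [hc] with s h1
    rw [h1]; push_cast; ring

theorem HasSlope.congr {f g : G.FinPoint → ℝ} {p : G.Point} {τ : G.Dir} {m : ℤ}
    {U : Set G.Point} (hU : IsOpen U) (hp : p ∈ U) (hτ : τ ∈ tangents p)
    (hfg : ∀ x, Point.fin x ∈ U → f x = g x) (hm : HasSlope f p τ m) : HasSlope g p τ m := by
  have h := isOpen_def.1 hU p hp τ hτ
  cases p with
  | fin x =>
    filter_upwards [hm, (eventually_map.1 h)] with s h1 h2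
    rw [← hfg _ h2, h1, hfg _ hp]
  | infty l =>
    obtain ⟨c, hc⟩ := hm
    refine ⟨c, ?_⟩
    filter_upwards [hc, (eventually_map.1 h)] with s h1 h2
    rw [← hfg _ h2, h1]

theorem RationalOn.ord_add {f g : G.FinPoint → ℝ} {U : Set G.Point} {p : G.Point}
    (hf : RationalOn f U) (hg : RationalOn g U) (hp : p ∈ U) :
    ord (fun x => f x + g x) p = ord f p + ord g p := by
  rw [ord, ord, ord, ← Finset.sum_add_distrib]
  refine Finset.sum_congr rfl fun τ hτ => ?_
  obtain ⟨m, hm⟩ := hf p hp τ hτ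
  obtain ⟨n, hn⟩ := hg p hp τ hτ
  rw [(hm.add hn).slope_eq, hm.slope_eq, hn.slope_eq]

theorem RationalOn.ord_neg {f : G.FinPoint → ℝ} {U : Set G.Point} {p : G.Point}
    (hf : RationalOn f U) (hp : p ∈ U) : ord (fun x => - f x) p = - ord f p := by
  rw [ord, ord, ← Finset.sum_neg_distrib]
  refine Finset.sum_congr rfl fun τ hτ => ?_
  obtain ⟨m, hm⟩ := hf p hp τ hτ
  rw [hm.neg.slope_eq, hm.slope_eq]

theorem RationalOn.add {f g : G.FinPoint → ℝ} {U : Set G.Point}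
    (hf : RationalOn f U) (hg : RationalOn g U) : RationalOn (fun x => f x + g x) U := by
  intro p hp τ hτ
  obtain ⟨m, hm⟩ := hf p hp τ hτ
  obtain ⟨n, hn⟩ := hg p hp τ hτ
  exact ⟨_, hm.add hn⟩

theorem RationalOn.neg {f : G.FinPoint → ℝ} {U : Set G.Point}
    (hf : RationalOn f U) : RationalOn (fun x => - f x) U := by
  intro p hp τ hτ
  obtain ⟨m, hm⟩ := hf p hp τ hτ
  exact ⟨_, hm.neg⟩

theorem RationalOn.mono {f : G.FinPoint → ℝ} {U W : Set G.Point}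
    (hf : RationalOn f U) (h : W ⊆ U) : RationalOn f W := fun p hp => hf p (h hp)

theorem AffineOn.mono {f : G.FinPoint → ℝ} {U W : Set G.Point}
    (hf : AffineOn f U) (h : W ⊆ U) : AffineOn f W := ⟨hf.1.mono h, fun p hp => hf.2 p (h hp)⟩

theorem AffineOn.add {f g : G.FinPoint → ℝ} {U : Set G.Point}
    (hf : AffineOn f U) (hg : AffineOn g U) : AffineOn (fun x => f x + g x) U :=
  ⟨hf.1.add hg.1, fun p hp => by rw [hf.1.ord_add hg.1 hp, hf.2 p hp, hg.2 p hp, add_zero]⟩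

theorem AffineOn.neg {f : G.FinPoint → ℝ} {U : Set G.Point}
    (hf : AffineOn f U) : AffineOn (fun x => - f x) U :=
  ⟨hf.1.neg, fun p hp => by rw [hf.1.ord_neg hp, hf.2 p hp, neg_zero]⟩

theorem AffineOn.congr {f g : G.FinPoint → ℝ} {U : Set G.Point} (hU : IsOpen U)
    (hfg : ∀ x, Point.fin x ∈ U → f x = g x) (hf : AffineOn f U) : AffineOn g U := by
  refine ⟨fun p hp τ hτ => ?_, fun p hp => ?_⟩
  · obtain ⟨m, hm⟩ := hf.1 p hp τ hτ
    exact ⟨m, hm.congr hU hp hτ hfg⟩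
  · rw [← hf.2 p hp]
    refine Finset.sum_congr rfl fun τ hτ => ?_
    obtain ⟨m, hm⟩ := hf.1 p hp τ hτ
    rw [(hm.congr hU hp hτ hfg).slope_eq, hm.slope_eq]

theorem AffineOn.of_local {f : G.FinPoint → ℝ} {U : Set G.Point}
    (h : ∀ p ∈ U, ∃ W, p ∈ W ∧ AffineOn f W) : AffineOn f U := by
  refine ⟨fun p hp => ?_, fun p hp => ?_⟩
  · obtain ⟨W, hpW, hW⟩ := h p hp
    exact hW.1 p hpW
  · obtain ⟨W, hpW, hW⟩ := h p hp
    exact hW.2 p hpW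

/-! ### Line bundles and the Picard group -/

variable (G) in
/-- A line bundle, given by a trivializing open covering and a Čech cocycle of transition
functions in `𝒪*`. -/
structure LineBundle where
  ι : Type u
  U : ι → Set G.Point
  isOpen_U : ∀ i, IsOpen (U i)
  covers : ∀ p, ∃ i, p ∈ U i
  f : ι → ι → G.FinPoint → ℝ
  affine : ∀ i j, AffineOn (f i j) (U i ∩ U j)
  cocycle : ∀ i j k x, Point.fin x ∈ U i ∩ U j ∩ U k → f i k x = f i j x + f j k x

namespace LineBundle

/-- Isomorphism of line bundles: the trivializations of one bundle differ from those of the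
other by affine functions `h i k`, compatibly with the transition functions. -/
def Iso (A B : G.LineBundle) : Prop :=
  ∃ h : A.ι → B.ι → G.FinPoint → ℝ,
    (∀ i k, AffineOn (h i k) (A.U i ∩ B.U k)) ∧
    (∀ i j k x, Point.fin x ∈ A.U i ∩ A.U j ∩ B.U k → h i k x = A.f i j x + h j k x) ∧
    (∀ i k l x, Point.fin x ∈ A.U i ∩ B.U k ∩ B.U l → h i l x = h i k x + B.f k l x)

theorem Iso.refl (A : G.LineBundle) : Iso A A :=
  ⟨A.f, A.affine, fun i j k x hx => A.cocycle i j k x hx, fun i k l x hx => A.cocycle i k l x hx⟩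

theorem Iso.symm {A B : G.LineBundle} : Iso A B → Iso B A := by
  rintro ⟨h, h1, h2, h3⟩
  refine ⟨fun k i x => - h i k x, fun k i => ?_, fun k l i x hx => ?_, fun k i j x hx => ?_⟩
  · rw [Set.inter_comm]; exact (h1 i k).neg
  · have := h3 i k l x ⟨⟨hx.2, hx.1.1⟩, hx.1.2⟩
    linarith
  · have := h2 i j k x ⟨⟨hx.1.2, hx.2⟩, hx.1.1⟩
    linarith

theorem Iso.trans {A B C : G.LineBundle} : Iso A B → Iso B C → Iso A C := by
  rintro ⟨h, h1, h2, h3⟩ ⟨h', h1', h2', h3'⟩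
  choose k hk using fun x => B.covers (Point.fin x)
  have key : ∀ i l m x, Point.fin x ∈ A.U i ∩ B.U l ∩ C.U m →
      h i l x + h' l m x = h i (k x) x + h' (k x) m x := by
    intro i l m x hx
    have e1 := h3 i l (k x) x ⟨hx.1, hk x⟩
    have e2 := h2' l (k x) m x ⟨⟨hx.1.2, hk x⟩, hx.2⟩
    linarith
  refine ⟨fun i m x => h i (k x) x + h' (k x) m x, fun i m => ?_, fun i j m x hx => ?_,
    fun i m n x hx => ?_⟩
  · refine AffineOn.of_local fun p hp => ?_
    obtain ⟨l, hl⟩ := B.covers p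
    refine ⟨A.U i ∩ B.U l ∩ C.U m, ⟨⟨hp.1, hl⟩, hp.2⟩, ?_⟩
    refine AffineOn.congr (((A.isOpen_U i).inter (B.isOpen_U l)).inter (C.isOpen_U m))
      (key i l m) (AffineOn.add ((h1 i l).mono ?_) ((h1' l m).mono ?_))
    · exact fun q hq => hq.1
    · exact fun q hq => ⟨hq.1.2, hq.2⟩
  · have := h2 i j (k x) x ⟨hx.1, hk x⟩
    simp only
    linarith
  · have := h3' (k x) m n x ⟨⟨hk x, hx.1.2⟩, hx.2⟩
    simp only
    linarith

instance setoid : Setoid G.LineBundle := ⟨Iso, Iso.refl, Iso.symm, Iso.trans⟩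

/-- `A.HasDivisor D`: the line bundle `A` has a (global) rational section `s` with divisor `D`.
Here `s i` is the expression of the section in the trivialization over `U i`. -/
def HasDivisor (A : G.LineBundle) (D : G.Divisor) : Prop :=
  ∃ s : A.ι → G.FinPoint → ℝ, (∀ i, RationalOn (s i) (A.U i)) ∧
    (∀ i j x, Point.fin x ∈ A.U i ∩ A.U j → s i x = A.f i j x + s j x) ∧
    ∀ i, ∀ p ∈ A.U i, ord (s i) p = D p

/-- A line bundle has degree `d` if it corresponds to a divisor of degree `d`. -/
def HasDegree (A : G.LineBundle) (d : ℤ) : Prop := ∃ D : G.Divisor, A.HasDivisor D ∧ D.deg = d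

end LineBundle

variable (G) in
/-- The set of isomorphism classes of line bundles, that is `H¹(C, 𝒪*)`. -/
def Pic : Type (u + 1) := Quotient (LineBundle.setoid (G := G))

variable (G) in
/-- Isomorphism classes of line bundles of degree `d`. -/
def PicDeg (d : ℤ) : Type (u + 1) :=
  {c : G.Pic // ∃ A : G.LineBundle, c = Quotient.mk _ A ∧ A.HasDegree d}

/-! ### The line bundle of a divisor -/

/-- A function given by its coordinate expressions in the interiors of edges and leaves. -/
def ofCoord (F : G.E → ℝ → ℝ) (K : G.L → ℝ → ℝ) : G.FinPoint → ℝ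
  | .vertex _ => 0
  | .edge e t _ _ => F e t
  | .leaf l t _ => K l t

theorem ofCoord_edgePt (F : G.E → ℝ → ℝ) (K : G.L → ℝ → ℝ) {e : G.E} {t : ℝ} (h₀ : 0 < t)
    (h₁ : t < G.len e) : ofCoord F K (edgePt e t) = F e t := by
  simp [edgePt, h₀, h₁, ofCoord]

theorem ofCoord_leafPt (F : G.E → ℝ → ℝ) (K : G.L → ℝ → ℝ) {l : G.L} {t : ℝ} (h₀ : 0 < t) :
    ofCoord F K (leafPt l t) = K l t := by
  simp [leafPt, h₀, ofCoord]

theorem eventually_pos_lt {c : ℝ} (hc : 0 < c) : ∀ᶠ s in 𝓝[>] (0 : ℝ), 0 < s ∧ s < c :=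
  Ioo_mem_nhdsGT hc

theorem eventually_ne_const (c : ℝ) : ∀ᶠ s in 𝓝[>] (0 : ℝ), s ≠ c := by
  rcases lt_or_ge 0 c with h | h
  · filter_upwards [eventually_pos_lt h] with s hs using hs.2.ne
  · filter_upwards [self_mem_nhdsWithin] with s hs
    have hs : 0 < s := hs
    exact (lt_of_le_of_lt h hs).ne'

theorem mem_tangents {p : G.Point} {τ : G.Dir} : τ ∈ tangents p ↔ IsTangent p τ := by
  simp [tangents]

theorem step_vertex_src (F : G.E → ℝ → ℝ) (K : G.L → ℝ → ℝ) (v : G.V) (e : G.E) :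
    ∀ᶠ s in 𝓝[>] (0 : ℝ), ofCoord F K (step (.vertex v) (.inl (e, true)) s) = F e s := by
  filter_upwards [eventually_pos_lt (G.len_pos e)] with s hs
  exact ofCoord_edgePt F K hs.1 hs.2

theorem step_vertex_tgt (F : G.E → ℝ → ℝ) (K : G.L → ℝ → ℝ) (v : G.V) (e : G.E) :
    ∀ᶠ s in 𝓝[>] (0 : ℝ),
      ofCoord F K (step (.vertex v) (.inl (e, false)) s) = F e (G.len e - s) := by
  filter_upwards [eventually_pos_lt (G.len_pos e)] with s hs
  exact ofCoord_edgePt F K (by linarith) (by linarith)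

theorem step_vertex_root (F : G.E → ℝ → ℝ) (K : G.L → ℝ → ℝ) (v : G.V) (l : G.L) (b : Bool) :
    ∀ᶠ s in 𝓝[>] (0 : ℝ), ofCoord F K (step (.vertex v) (.inr (l, b)) s) = K l s := by
  filter_upwards [eventually_pos_lt one_pos] with s hs
  exact ofCoord_leafPt F K hs.1

theorem step_edge_true (F : G.E → ℝ → ℝ) (K : G.L → ℝ → ℝ) (e e' : G.E) (t : ℝ) (h₀ : 0 < t)
    (h₁ : t < G.len e) : ∀ᶠ s in 𝓝[>] (0 : ℝ),
      ofCoord F K (step (.edge e t h₀ h₁) (.inl (e', true)) s) = F e (t + s) := by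
  filter_upwards [eventually_pos_lt (sub_pos.2 h₁)] with s hs
  exact ofCoord_edgePt F K (by linarith) (by linarith)

theorem step_edge_false (F : G.E → ℝ → ℝ) (K : G.L → ℝ → ℝ) (e e' : G.E) (t : ℝ) (h₀ : 0 < t)
    (h₁ : t < G.len e) : ∀ᶠ s in 𝓝[>] (0 : ℝ),
      ofCoord F K (step (.edge e t h₀ h₁) (.inl (e', false)) s) = F e (t - s) := by
  filter_upwards [eventually_pos_lt h₀] with s hs
  exact ofCoord_edgePt F K (by linarith) (by linarith)

theorem step_leaf_true (F : G.E → ℝ → ℝ) (K : G.L → ℝ → ℝ) (l l' : G.L) (t : ℝ) (h₀ : 0 < t) :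
    ∀ᶠ s in 𝓝[>] (0 : ℝ),
      ofCoord F K (step (.leaf l t h₀) (.inr (l', true)) s) = K l (t + s) := by
  filter_upwards [eventually_pos_lt one_pos] with s hs
  exact ofCoord_leafPt F K (by linarith)

theorem step_leaf_false (F : G.E → ℝ → ℝ) (K : G.L → ℝ → ℝ) (l l' : G.L) (t : ℝ) (h₀ : 0 < t) :
    ∀ᶠ s in 𝓝[>] (0 : ℝ),
      ofCoord F K (step (.leaf l t h₀) (.inr (l', false)) s) = K l (t - s) := by
  filter_upwards [eventually_pos_lt h₀] with s hs
  exact ofCoord_leafPt F K (by linarith)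

theorem germ_ne {p : G.Point} {τ : G.Dir} (hτ : τ ∈ tangents p) (q : G.Point) :
    ∀ᶠ y in germ p τ, Point.fin y ≠ q := by
  cases q with
  | infty l => exact Eventually.of_forall fun y h => by cases h
  | fin z =>
    set F : G.E → ℝ → ℝ := fun _ t => t
    set K : G.L → ℝ → ℝ := fun _ t => t
    suffices h : ∀ᶠ y in germ p τ, ofCoord F K y ≠ ofCoord F K z by
      filter_upwards [h] with y hy hyz
      cases hyz; exact hy rfl
    rw [mem_tangents] at hτ
    generalize ofCoord F K z = c
    rcases p with (⟨v⟩ | ⟨e, t, h₀, h₁⟩ | ⟨l, t, h₀⟩) | ⟨l⟩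
    · rcases τ with ⟨e, _ | _⟩ | ⟨l, b⟩
      · refine eventually_map.2 ?_
        filter_upwards [step_vertex_tgt F K v e, eventually_ne_const (G.len e - c)] with s h1 h2
        rw [h1]; intro h; exact h2 (by simp only [F] at h; linarith)
      · refine eventually_map.2 ?_
        filter_upwards [step_vertex_src F K v e, eventually_ne_const c] with s h1 h2
        rw [h1]; exact h2
      · refine eventually_map.2 ?_
        filter_upwards [step_vertex_root F K v l b, eventually_ne_const c] with s h1 h2
        rw [h1]; exact h2
    · rcases τ with ⟨e', _ | _⟩ | ⟨l, b⟩
      · refine eventually_map.2 ?_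
        filter_upwards [step_edge_false F K e e' t h₀ h₁, eventually_ne_const (t - c)] with s h1 h2
        rw [h1]; intro h; exact h2 (by simp only [F] at h; linarith)
      · refine eventually_map.2 ?_
        filter_upwards [step_edge_true F K e e' t h₀ h₁, eventually_ne_const (c - t)] with s h1 h2
        rw [h1]; intro h; exact h2 (by simp only [F] at h; linarith)
      · exact absurd hτ id
    · rcases τ with ⟨e', b⟩ | ⟨l', _ | _⟩
      · exact absurd hτ id
      · refine eventually_map.2 ?_
        filter_upwards [step_leaf_false F K l l' t h₀, eventually_ne_const (t - c)] with s h1 h2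
        rw [h1]; intro h; exact h2 (by simp only [K] at h; linarith)
      · refine eventually_map.2 ?_
        filter_upwards [step_leaf_true F K l l' t h₀, eventually_ne_const (c - t)] with s h1 h2
        rw [h1]; intro h; exact h2 (by simp only [K] at h; linarith)
    · refine eventually_map.2 ?_
      filter_upwards [eventually_gt_atTop 0, eventually_ne_atTop c] with t h1 h2
      rw [ofCoord_leafPt F K h1]; exact h2

theorem isOpen_compl_finite {B : Set G.Point} (hB : B.Finite) : IsOpen Bᶜ := by
  refine isOpen_def.2 fun p _ τ hτ => ?_
  have h : ∀ᶠ y in germ p τ, ∀ q ∈ B, Point.fin y ≠ q :=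
    (eventually_all_finite hB).2 fun q _ => germ_ne hτ q
  filter_upwards [h] with y hy hyB using hy _ hyB rfl

/-- A real function is affine with integral slope near `t`. -/
def LocAffine (g : ℝ → ℝ) (t : ℝ) : Prop := ∃ (m : ℤ) (c : ℝ), ∀ᶠ t' in 𝓝 t, g t' = c + m * t'

theorem LocAffine.slopes {g : ℝ → ℝ} {t : ℝ} (h : LocAffine g t) :
    ∃ m : ℤ, (∀ᶠ s in 𝓝[>] (0 : ℝ), g (t + s) = g t + m * s) ∧
      ∀ᶠ s in 𝓝[>] (0 : ℝ), g (t - s) = g t + (-m : ℤ) * s := by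
  obtain ⟨m, c, h⟩ := h
  have h0 := h.self_of_nhds
  have h1 : Tendsto (fun s : ℝ => t + s) (𝓝[>] 0) (𝓝 t) := by
    have : Tendsto (fun s : ℝ => t + s) (𝓝 0) (𝓝 (t + 0)) := by
      exact (continuous_const.add continuous_id).tendsto 0
    rw [add_zero] at this
    exact this.mono_left nhdsWithin_le_nhds
  have h2 : Tendsto (fun s : ℝ => t - s) (𝓝[>] 0) (𝓝 t) := by
    have : Tendsto (fun s : ℝ => t - s) (𝓝 0) (𝓝 (t - 0)) := by
      exact (continuous_const.sub continuous_id).tendsto 0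
    rw [sub_zero] at this
    exact this.mono_left nhdsWithin_le_nhds
  refine ⟨m, ?_, ?_⟩
  · filter_upwards [h1.eventually h] with s hs
    rw [hs, h0]; ring
  · filter_upwards [h2.eventually h] with s hs
    rw [hs, h0]; push_cast; ring

open Classical in
theorem tangents_edge (e : G.E) (t : ℝ) (h₀ : 0 < t) (h₁ : t < G.len e) :
    tangents (.fin (.edge e t h₀ h₁)) = {.inl (e, true), .inl (e, false)} := by
  ext τ
  rw [mem_tangents]
  rcases τ with ⟨e', _ | _⟩ | ⟨l, b⟩ <;> simp [IsTangent]

open Classical in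
theorem tangents_leaf (l : G.L) (t : ℝ) (h₀ : 0 < t) :
    tangents (.fin (.leaf l t h₀)) = {.inr (l, true), .inr (l, false)} := by
  ext τ
  rw [mem_tangents]
  rcases τ with ⟨e', b⟩ | ⟨l', _ | _⟩ <;> simp [IsTangent]

theorem tangents_infty (l : G.L) : tangents (.infty l) = {.inr (l, false)} := by
  ext τ
  rw [mem_tangents]
  rcases τ with ⟨e', b⟩ | ⟨l', _ | _⟩ <;> simp [IsTangent]

open Classical in
/-- Slopes `a` forward and `b` backward at a point of an edge. -/
theorem ord_edge {F : G.E → ℝ → ℝ} {K : G.L → ℝ → ℝ} {e : G.E} {t : ℝ} (h₀ : 0 < t)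
    (h₁ : t < G.len e) {a b : ℤ} (ha : ∀ᶠ s in 𝓝[>] (0 : ℝ), F e (t + s) = F e t + a * s)
    (hb : ∀ᶠ s in 𝓝[>] (0 : ℝ), F e (t - s) = F e t + b * s) :
    RationalOn (ofCoord F K) {.fin (.edge e t h₀ h₁)} ∧
      ord (ofCoord F K) (.fin (.edge e t h₀ h₁)) = a + b := by
  have h1 : HasSlope (ofCoord F K) (.fin (.edge e t h₀ h₁)) (.inl (e, true)) a := by
    filter_upwards [ha, step_edge_true F K e e t h₀ h₁] with s h1 h2
    rw [h2, h1]; rfl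
  have h2 : HasSlope (ofCoord F K) (.fin (.edge e t h₀ h₁)) (.inl (e, false)) b := by
    filter_upwards [hb, step_edge_false F K e e t h₀ h₁] with s h1 h2
    rw [h2, h1]; rfl
  refine ⟨?_, ?_⟩
  · rintro _ rfl τ hτ
    rw [tangents_edge] at hτ
    simp only [Finset.mem_insert, Finset.mem_singleton] at hτ
    rcases hτ with rfl | rfl
    exacts [⟨a, h1⟩, ⟨b, h2⟩]
  · rw [ord, tangents_edge, Finset.sum_pair (by simp), h1.slope_eq, h2.slope_eq]

open Classical in
/-- Slopes `a` forward and `b` backward at a point of a leaf. -/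
theorem ord_leaf {F : G.E → ℝ → ℝ} {K : G.L → ℝ → ℝ} {l : G.L} {t : ℝ} (h₀ : 0 < t)
    {a b : ℤ} (ha : ∀ᶠ s in 𝓝[>] (0 : ℝ), K l (t + s) = K l t + a * s)
    (hb : ∀ᶠ s in 𝓝[>] (0 : ℝ), K l (t - s) = K l t + b * s) :
    RationalOn (ofCoord F K) {.fin (.leaf l t h₀)} ∧
      ord (ofCoord F K) (.fin (.leaf l t h₀)) = a + b := by
  have h1 : HasSlope (ofCoord F K) (.fin (.leaf l t h₀)) (.inr (l, true)) a := by
    filter_upwards [ha, step_leaf_true F K l l t h₀] with s h1 h2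
    rw [h2, h1]; rfl
  have h2 : HasSlope (ofCoord F K) (.fin (.leaf l t h₀)) (.inr (l, false)) b := by
    filter_upwards [hb, step_leaf_false F K l l t h₀] with s h1 h2
    rw [h2, h1]; rfl
  refine ⟨?_, ?_⟩
  · rintro _ rfl τ hτ
    rw [tangents_leaf] at hτ
    simp only [Finset.mem_insert, Finset.mem_singleton] at hτ
    rcases hτ with rfl | rfl
    exacts [⟨a, h1⟩, ⟨b, h2⟩]
  · rw [ord, tangents_leaf, Finset.sum_pair (by simp), h1.slope_eq, h2.slope_eq]

theorem exists_tangent_vertex (v : G.V) : ∃ τ, τ ∈ tangents (G := G) (.fin (.vertex v)) := by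
  by_contra hne
  push Not at hne
  simp only [mem_tangents] at hne
  have h1 : IsEmpty {e // G.src e = v} := ⟨fun e => hne (.inl (e.1, true)) e.2⟩
  have h2 : IsEmpty {e // G.tgt e = v} := ⟨fun e => hne (.inl (e.1, false)) e.2⟩
  have h3 : IsEmpty {l // G.root l = v} := ⟨fun l => hne (.inr (l.1, true)) l.2⟩
  have := G.two_le_valence v
  simp at this

theorem LocAffine.zero (t : ℝ) : LocAffine (fun _ => 0) t :=
  ⟨0, 0, Eventually.of_forall fun _ => by simp⟩

theorem LocAffine.ite_lt {g h : ℝ → ℝ} {t c : ℝ} (hg : LocAffine g t) (hh : LocAffine h t)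
    (hc : t ≠ c) : LocAffine (fun t => if t < c then g t else h t) t := by
  rcases lt_or_gt_of_ne hc with hc | hc
  · obtain ⟨m, a, hg⟩ := hg
    refine ⟨m, a, ?_⟩
    filter_upwards [hg, eventually_lt_nhds hc] with s h1 h2
    simp [h1, h2]
  · obtain ⟨m, a, hh⟩ := hh
    refine ⟨m, a, ?_⟩
    filter_upwards [hh, eventually_gt_nhds hc] with s h1 h2
    simp [h1, h2.le]

theorem LocAffine.lin (n : ℤ) (a t : ℝ) : LocAffine (fun t => n * (t - a)) t :=
  ⟨n, - n * a, Eventually.of_forall fun _ => by ring⟩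

open Classical in
/-- For every point `p` and integer `n` there is a function, affine in the coordinate near all
points of the interiors of edges and leaves other than `p` and the midpoints of edges, that is
rational at `p` and has order `n` there. -/
theorem exists_coord (p : G.Point) (n : ℤ) : ∃ (F : G.E → ℝ → ℝ) (K : G.L → ℝ → ℝ),
    (∀ e t h₀ h₁, Point.fin (.edge e t h₀ h₁) ≠ p → t ≠ G.len e / 2 → LocAffine (F e) t) ∧
    (∀ l t h₀, Point.fin (.leaf l t h₀) ≠ p → LocAffine (K l) t) ∧
    RationalOn (ofCoord F K) {p} ∧ ord (ofCoord F K) p = n := by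
  have aux : ∀ (F : G.E → ℝ → ℝ) (K : G.L → ℝ → ℝ) (τ₀ : G.Dir), τ₀ ∈ tangents p →
      (∀ τ ∈ tangents p, HasSlope (ofCoord F K) p τ (if τ = τ₀ then n else 0)) →
      RationalOn (ofCoord F K) {p} ∧ ord (ofCoord F K) p = n := by
    intro F K τ₀ h₀ h
    refine ⟨?_, ?_⟩
    · rintro _ rfl τ hτ
      exact ⟨_, h τ hτ⟩
    · rw [ord, Finset.sum_congr rfl fun τ hτ => (h τ hτ).slope_eq, Finset.sum_ite_eq']
      simp [h₀]
  rcases p with (⟨v⟩ | ⟨e₀, t₀, h₀, h₁⟩ | ⟨l₀, t₀, h₀⟩) | ⟨l₀⟩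
  · obtain ⟨τ₀, hτ₀⟩ := exists_tangent_vertex v
    set F : G.E → ℝ → ℝ := fun e t => if t < G.len e / 2
      then (if Sum.inl (e, true) = τ₀ then n else 0 : ℤ) * (t - 0)
      else (if Sum.inl (e, false) = τ₀ then -n else 0 : ℤ) * (t - G.len e) with hF
    set K : G.L → ℝ → ℝ := fun l t =>
      (if Sum.inr (l, true) = τ₀ then n else 0 : ℤ) * (t - 0) with hK
    refine ⟨F, K, fun e t _ _ _ ht => ?_, fun l t _ _ => LocAffine.lin _ _ _, ?_⟩
    · exact LocAffine.ite_lt (LocAffine.lin _ _ _) (LocAffine.lin _ _ _) ht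
    · refine aux F K τ₀ hτ₀ fun τ hτ => ?_
      rw [mem_tangents] at hτ
      rcases τ with ⟨e, _ | _⟩ | ⟨l, _ | _⟩
      · filter_upwards [step_vertex_tgt F K v e,
          eventually_pos_lt (half_pos (G.len_pos e))] with s h1 h2
        have : ¬ (G.len e - s < G.len e / 2) := by linarith [h2.2]
        rw [h1]
        simp only [hF, if_neg this, ofCoord]
        split_ifs <;> push_cast <;> ring
      · filter_upwards [step_vertex_src F K v e,
          eventually_pos_lt (half_pos (G.len_pos e))] with s h1 h2
        rw [h1]
        simp only [hF, if_pos h2.2, ofCoord]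
        ring
      · exact absurd hτ id
      · filter_upwards [step_vertex_root F K v l true] with s h1
        rw [h1]
        simp only [hK, ofCoord]
        ring
  · set F : G.E → ℝ → ℝ := fun e t => if e = e₀ then
      (if t < t₀ then 0 else n * (t - t₀)) else 0 with hF
    refine ⟨F, fun _ _ => 0, fun e t _ _ hp _ => ?_, fun l t _ _ => LocAffine.zero _, ?_⟩
    · by_cases he : e = e₀
      · subst he
        simp only [hF, if_true]
        refine LocAffine.ite_lt (LocAffine.zero _) (LocAffine.lin _ _ _) ?_
        rintro rfl; exact hp rfl
      · simp only [hF, if_neg he]; exact LocAffine.zero _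
    · have := ord_edge (F := F) (K := fun _ _ => 0) (e := e₀) h₀ h₁ (a := n) (b := 0) ?_ ?_
      · simpa using this
      · filter_upwards [self_mem_nhdsWithin] with s hs
        have hs : 0 < s := hs
        simp [hF, hs.le]
      · filter_upwards [self_mem_nhdsWithin] with s hs
        have hs : 0 < s := hs
        simp [hF, hs]
  · set K : G.L → ℝ → ℝ := fun l t => if l = l₀ then
      (if t < t₀ then 0 else n * (t - t₀)) else 0 with hK
    refine ⟨fun _ _ => 0, K, fun e t _ _ _ _ => LocAffine.zero _, fun l t _ hp => ?_, ?_⟩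
    · by_cases he : l = l₀
      · subst he
        simp only [hK, if_true]
        refine LocAffine.ite_lt (LocAffine.zero _) (LocAffine.lin _ _ _) ?_
        rintro rfl; exact hp rfl
      · simp only [hK, if_neg he]; exact LocAffine.zero _
    · have := ord_leaf (F := fun _ _ => 0) (K := K) (l := l₀) h₀ (a := n) (b := 0) ?_ ?_
      · simpa using this
      · filter_upwards [self_mem_nhdsWithin] with s hs
        have hs : 0 < s := hs
        simp [hK, hs.le]
      · filter_upwards [self_mem_nhdsWithin] with s hs
        have hs : 0 < s := hs
        simp [hK, hs]
  · refine ⟨fun _ _ => 0, fun _ t => (-n : ℤ) * (t - 0), fun e t _ _ _ _ => LocAffine.zero _,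
      fun l t _ hp => LocAffine.lin _ _ _, ?_⟩
    refine aux _ _ (.inr (l₀, false)) (by simp [tangents_infty]) fun τ hτ => ?_
    rw [tangents_infty, Finset.mem_singleton] at hτ
    subst hτ
    refine ⟨0, ?_⟩
    filter_upwards [eventually_gt_atTop 0] with t ht
    rw [ofCoord_leafPt _ _ ht]
    simp

theorem RationalOn.of_local {f : G.FinPoint → ℝ} {U : Set G.Point}
    (h : ∀ p ∈ U, RationalOn f {p}) : RationalOn f U := fun p hp => h p hp p rfl

/-- Every divisor is locally the divisor of a rational function. -/
theorem exists_local_equation (D : G.Divisor) (p : G.Point) : ∃ (U : Set G.Point)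
    (f : G.FinPoint → ℝ), p ∈ U ∧ IsOpen U ∧ RationalOn f U ∧ ∀ q ∈ U, ord f q = D q := by
  obtain ⟨F, K, hF, hK, hp, hn⟩ := exists_coord p (D p)
  set B : Set G.Point := (Set.range (fun v => Point.fin (.vertex v)) ∪
    Set.range (fun l => Point.infty l) ∪
    Set.range (fun e => Point.fin (.edge e (G.len e / 2) (half_pos (G.len_pos e))
      (half_lt_self (G.len_pos e)))) ∪ (D.support : Set G.Point)) \ {p} with hB
  have hfin : B.Finite := by
    refine Set.Finite.subset ?_ Set.sdiff_subset
    exact (((Set.finite_range _).union (Set.finite_range _)).union (Set.finite_range _)).union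
      D.support.finite_toSet
  have key : ∀ q ∈ Bᶜ, RationalOn (ofCoord F K) {q} ∧ ord (ofCoord F K) q = D q := by
    intro q hq
    by_cases hqp : q = p
    · subst hqp; exact ⟨hp, hn⟩
    · have hq' : q ∉ (Set.range (fun v => Point.fin (.vertex v)) ∪
          Set.range (fun l => Point.infty l) ∪
          Set.range (fun e => Point.fin (.edge e (G.len e / 2) (half_pos (G.len_pos e))
            (half_lt_self (G.len_pos e)))) ∪ (D.support : Set G.Point)) :=
        fun h => hq ⟨h, hqp⟩
      simp only [Set.mem_union, not_or, Finset.mem_coe, Finsupp.mem_support_iff, not_not] at hq'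
      obtain ⟨⟨⟨q1, q2⟩, q3⟩, q4⟩ := hq'
      rw [q4]
      rcases q with (⟨v⟩ | ⟨e, t, h₀, h₁⟩ | ⟨l, t, h₀⟩) | ⟨l⟩
      · exact absurd ⟨v, rfl⟩ q1
      · have ht : t ≠ G.len e / 2 := by
          rintro rfl; exact q3 ⟨e, rfl⟩
        obtain ⟨m, h1, h2⟩ := (hF e t h₀ h₁ hqp ht).slopes
        simpa using ord_edge (F := F) (K := K) h₀ h₁ h1 h2
      · obtain ⟨m, h1, h2⟩ := (hK l t h₀ hqp).slopes
        simpa using ord_leaf (F := F) (K := K) h₀ h1 h2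
      · exact absurd ⟨l, rfl⟩ q2
  exact ⟨Bᶜ, ofCoord F K, fun h => h.2 rfl, isOpen_compl_finite hfin,
    RationalOn.of_local fun q hq => (key q hq).1, fun q hq => (key q hq).2⟩

/-- The line bundle `L(D)` of a divisor: the trivializing sets are all open sets `U` with a
rational function `f` on `U` whose divisor is `D` on `U`; the transition functions are the
differences of these local equations of `D`. -/
def LineBundle.ofDivisor (D : G.Divisor) : G.LineBundle where
  ι := {i : Set G.Point × (G.FinPoint → ℝ) //
    IsOpen i.1 ∧ RationalOn i.2 i.1 ∧ ∀ p ∈ i.1, ord i.2 p = D p}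
  U i := i.1.1
  isOpen_U i := i.2.1
  covers p := by
    obtain ⟨U, f, hp, hU, hf, hD⟩ := exists_local_equation D p
    exact ⟨⟨(U, f), hU, hf, hD⟩, hp⟩
  f i j x := i.1.2 x + - j.1.2 x
  affine i j := by
    have hi := i.2.2.1.mono (W := i.1.1 ∩ j.1.1) Set.inter_subset_left
    have hj := j.2.2.1.mono (W := i.1.1 ∩ j.1.1) Set.inter_subset_right
    refine ⟨hi.add hj.neg, fun p hp => ?_⟩
    rw [hi.ord_add hj.neg hp, hj.ord_neg hp, i.2.2.2 p hp.1, j.2.2.2 p hp.2, add_neg_cancel]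
  cocycle i j k x _ := by ring

/-- The local equations of `D` are a rational section of `L(D)` with divisor `D`. -/
theorem LineBundle.hasDivisor_ofDivisor (D : G.Divisor) :
    (LineBundle.ofDivisor D).HasDivisor D :=
  ⟨fun i => i.1.2, fun i => i.2.2.1,
    fun i j x _ => by simp [LineBundle.ofDivisor], fun i => i.2.2.2⟩

/-- The map `Div^d(C) → Pic^d(C)` sending `D` to the class of `L(D)`. -/
def PicDeg.ofDivisor {d : ℤ} (D : G.DivDeg d) : G.PicDeg d :=
  ⟨Quotient.mk _ (LineBundle.ofDivisor D.1), _, rfl, D.1, LineBundle.hasDivisor_ofDivisor D.1, D.2⟩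

/-! ### One-forms, the Jacobian and the Abel-Jacobi map -/

variable (G) in
/-- The real vector space `Ω(C)` of 1-forms: a form assigns to each oriented edge or leaf its
(constant) value on the primitive tangent vector in that direction, and is balanced, i.e. its
values on the outward primitive tangent vectors add up to zero, at each point of the curve. -/
def Form : Submodule ℝ (G.Dir → ℝ) where
  carrier := {ω | (∀ e, ω (.inl (e, false)) = - ω (.inl (e, true))) ∧
    (∀ l, ω (.inr (l, false)) = - ω (.inr (l, true))) ∧
    ∀ p : G.Point, ∑ τ ∈ tangents p, ω τ = 0}
  zero_mem' := by simp
  add_mem' := by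
    rintro a b ⟨ha, ha', ha''⟩ ⟨hb, hb', hb''⟩
    refine ⟨fun e => ?_, fun l => ?_, fun p => ?_⟩
    · simp only [Pi.add_apply, ha, hb]; ring
    · simp only [Pi.add_apply, ha', hb']; ring
    · simp only [Pi.add_apply, Finset.sum_add_distrib, ha'', hb'', add_zero]
  smul_mem' := by
    rintro c a ⟨ha, ha', ha''⟩
    refine ⟨fun e => ?_, fun l => ?_, fun p => ?_⟩
    · simp only [Pi.smul_apply, ha, smul_neg]
    · simp only [Pi.smul_apply, ha', smul_neg]
    · simp only [Pi.smul_apply, ← Finset.smul_sum, ha'', smul_zero]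

/-- A 1-form vanishes on the leaves, by the balancing condition at the endpoints. -/
theorem Form.leaf_eq_zero (ω : G.Form) (l : G.L) (b : Bool) : ω.1 (.inr (l, b)) = 0 := by
  have h := ω.2.2.2 (.infty l)
  rw [tangents_infty, Finset.sum_singleton] at h
  cases b
  · exact h
  · have := ω.2.2.1 l
    linarith

/-- The value of 1-forms on an oriented edge or leaf, as a linear functional. -/
def Form.eval (τ : G.Dir) : Module.Dual ℝ G.Form := (LinearMap.proj τ).comp G.Form.subtype

/-- Paths in the curve: concatenations of intervals in edges and leaves, and their reverses. -/
inductive Path : G.Point → G.Point → Type u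
  | refl (p : G.Point) : Path p p
  | edge (e : G.E) (s t : ℝ) (hs : s ∈ Set.Icc 0 (G.len e)) (ht : t ∈ Set.Icc 0 (G.len e)) :
      Path (.fin (edgePt e s)) (.fin (edgePt e t))
  | leaf (l : G.L) (s t : ℝ) (hs : 0 ≤ s) (ht : 0 ≤ t) :
      Path (.fin (leafPt l s)) (.fin (leafPt l t))
  | ray (l : G.L) (s : ℝ) (hs : 0 ≤ s) : Path (.fin (leafPt l s)) (.infty l)
  | symm {p q : G.Point} (γ : Path p q) : Path q p
  | trans {p q r : G.Point} (γ : Path p q) (δ : Path q r) : Path p r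

/-- Integration of 1-forms along a path. The integral along an infinite ray vanishes, since forms
vanish on leaves. -/
def Path.integral : {p q : G.Point} → Path p q → Module.Dual ℝ G.Form
  | _, _, .refl _ => 0
  | _, _, .edge e s t _ _ => (t - s) • Form.eval (.inl (e, true))
  | _, _, .leaf l s t _ _ => (t - s) • Form.eval (.inr (l, true))
  | _, _, .ray _ _ _ => 0
  | _, _, .symm γ => - γ.integral
  | _, _, .trans γ δ => γ.integral + δ.integral

open Classical in
variable (G) in
/-- The cellular boundary map. The 1-cells are the edges and leaves (oriented away from the
root), the 0-cells are the vertices in `V` and the endpoints of the leaves. -/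
def boundary : (G.E ⊕ G.L → ℤ) →ₗ[ℤ] (G.V ⊕ G.L → ℤ) :=
  Fintype.linearCombination ℤ (Sum.elim
    (fun e => Pi.single (.inl (G.tgt e)) 1 - Pi.single (.inl (G.src e)) 1)
    (fun l => Pi.single (.inr l) 1 - Pi.single (.inl (G.root l)) 1))

variable (G) in
/-- The group `H₁(C, ℤ)` of integral cycles. -/
abbrev H1 : Type u := LinearMap.ker G.boundary

variable (G) in
/-- Integration of 1-forms along integral cycles (on the leaves forms vanish). -/
def period : G.H1 →+ Module.Dual ℝ G.Form where
  toFun c := ∑ e, (c.1 (.inl e) : ℤ) • (G.len e • Form.eval (.inl (e, true)))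
  map_zero' := by simp
  map_add' a b := by simp [add_smul, Finset.sum_add_distrib]

variable (G) in
/-- The Jacobian `J(C) = Ω(C)* / H₁(C, ℤ)`. -/
abbrev Jacobian : Type u := Module.Dual ℝ G.Form ⧸ G.period.range

/-- The functional `∑ aᵢ ∫_{p₀}^{pᵢ}` for the divisor `∑ aᵢ pᵢ`, with given paths of
integration. -/
def integralAlong {p₀ : G.Point} (γ : ∀ p, Path p₀ p) (D : G.Divisor) : Module.Dual ℝ G.Form :=
  D.sum fun p a => a • (γ p).integral

theorem edgePt_zero (e : G.E) : edgePt e 0 = .vertex (G.src e) := by simp [edgePt]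

theorem edgePt_len (e : G.E) : edgePt e (G.len e) = .vertex (G.tgt e) := by
  simp [edgePt, G.len_pos e]

theorem leafPt_zero (l : G.L) : leafPt l 0 = .vertex (G.root l) := by simp [leafPt]

/-- The curve is path connected. -/
theorem nonempty_path (p q : G.Point) : Nonempty (Path p q) := by
  have hV : ∀ v w : G.V, Nonempty (Path (G := G) (.fin (.vertex v)) (.fin (.vertex w))) := by
    intro v w
    induction G.connected v w with
    | rel a b h =>
      obtain ⟨e, rfl, rfl⟩ := h
      rw [← edgePt_zero, ← edgePt_len]
      exact ⟨.edge e _ _ ⟨le_rfl, (G.len_pos e).le⟩ ⟨(G.len_pos e).le, le_rfl⟩⟩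
    | refl a => exact ⟨.refl _⟩
    | symm a b _ h => exact h.map .symm
    | trans a b c _ _ h h' => exact ⟨h.some.trans h'.some⟩
  have hp : ∀ p : G.Point, ∃ v : G.V, Nonempty (Path (.fin (.vertex v)) p) := by
    rintro ((⟨v⟩ | ⟨e, t, h₀, h₁⟩ | ⟨l, t, h₀⟩) | ⟨l⟩)
    · exact ⟨v, ⟨.refl _⟩⟩
    · refine ⟨G.src e, ?_⟩
      rw [← edgePt_zero, show FinPoint.edge e t h₀ h₁ = edgePt e t by simp [edgePt, h₀, h₁]]
      exact ⟨.edge e _ _ ⟨le_rfl, (G.len_pos e).le⟩ ⟨h₀.le, h₁.le⟩⟩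
    · refine ⟨G.root l, ?_⟩
      rw [← leafPt_zero, show FinPoint.leaf l t h₀ = leafPt l t by simp [leafPt, h₀]]
      exact ⟨.leaf l _ _ le_rfl h₀.le⟩
    · refine ⟨G.root l, ?_⟩
      rw [← leafPt_zero]
      exact ⟨.ray l _ le_rfl⟩
  obtain ⟨v, ⟨γ⟩⟩ := hp p
  obtain ⟨w, ⟨δ⟩⟩ := hp q
  exact ⟨γ.symm.trans ((hV v w).some.trans δ)⟩

/-- The Abel-Jacobi map `μ : Div^d(C) → J(C)` with base point `p₀`: the class of
`∑ aᵢ ∫_{p₀}^{pᵢ}`, for some choice of the paths. -/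
def abelJacobi (p₀ : G.Point) {d : ℤ} (D : G.DivDeg d) : G.Jacobian :=
  QuotientAddGroup.mk (integralAlong (fun p => (nonempty_path p₀ p).some) D.1)

end TropicalCurve

end

namespace TropicalCurve

/-! ### Piecewise affine functions of a real variable -/

/-! Both D ↦ [L(D)] and μ are surjections from the divisors of degree d, so everything reduces to
showing that they have the same fibres. A line bundle has degree d exactly when it has a rational
section whose divisor has degree d, and such a section identifies the bundle with the L(D) of its
divisor; two sections of one bundle differ by a global rational function. Hence the fibres of D ↦
[L(D)] are the classes modulo principal divisors (`PicDeg.ofDivisor_eq_iff`). That the same holds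
for μ is the tropical Abel theorem `isPrincipal_iff_integralAlong_mem`.

For Abel's theorem the problem is made combinatorial on both sides. On an edge, a function with
divisor D is c + m t plus a sum of kinks at the points of D, so its final slope is m + `mass` and
its increment is (m + `mass`) · len − `moment`. Such functions glue if and only if these increments
form a coboundary of vertex values and the slopes balance at the vertices (`isPrincipal_iff`).
Leaves impose only their initial slope, which D determines. On the other side, retracting every
point to the starting vertex of its edge or leaf writes the integral of D, of degree zero, as the
moments of D plus the integral of an integral edge chain N (`exists_integralAlong_eq`).

Forms are the closed real edge chains, so a functional ∑ aₑ ∫ along unit vectors vanishes on forms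
if and only if a is a coboundary (`sum_smul_eval_eq_zero_iff`). Applied to the increments, this says
that the integral of D equals the integral of the chain N + m + `mass`; the balancing at the
vertices says that this chain is closed. So D is principal if and only if its integral is a period.

Surjectivity of μ holds because evaluations on edges span Ω*, and a real multiple of such an
evaluation is an integer multiple of the integral over a segment of the edge
(`exists_integralAlong_sub_mem`). -/

theorem eventually_nhdsGT_zero_iff {P : ℝ → Prop} :
    (∀ᶠ s in 𝓝[>] (0 : ℝ), P s) ↔ ∃ ε > 0, ∀ s, 0 < s → s < ε → P s := by
  rw [Filter.Eventually, mem_nhdsGT_iff_exists_Ioo_subset]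
  exact ⟨fun ⟨ε, h, hs⟩ => ⟨ε, h, fun s h0 h1 => hs ⟨h0, h1⟩⟩,
    fun ⟨ε, h, hs⟩ => ⟨ε, h, fun s hs' => hs s hs'.1 hs'.2⟩⟩

/-- Two affine functions that agree on the right of `0` are equal. -/
theorem affine_eq_of_eventually {a b a' b' : ℝ}
    (h : ∀ᶠ s in 𝓝[>] (0 : ℝ), a + b * s = a' + b' * s) : a = a' ∧ b = b' := by
  obtain ⟨ε, hε, h⟩ := eventually_nhdsGT_zero_iff.1 h
  have h1 := h (ε / 2) (by linarith) (by linarith)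
  have h2 := h (ε / 4) (by linarith) (by linarith)
  have h3 : (b - b') * ε = 0 := by linarith
  have h4 : b = b' := by
    rcases mul_eq_zero.1 h3 with h | h <;> linarith
  subst h4
  exact ⟨by linarith, rfl⟩

/-- `F` has outward slopes `r` to the right and `l` to the left of `t`. -/
def HasSlopes (F : ℝ → ℝ) (t : ℝ) (r l : ℤ) : Prop :=
  (∀ᶠ s in 𝓝[>] (0 : ℝ), F (t + s) = F t + r * s) ∧
    ∀ᶠ s in 𝓝[>] (0 : ℝ), F (t - s) = F t + l * s

theorem HasSlopes.add {F H : ℝ → ℝ} {t : ℝ} {r l r' l' : ℤ} (hF : HasSlopes F t r l)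
    (hH : HasSlopes H t r' l') : HasSlopes (fun x => F x + H x) t (r + r') (l + l') := by
  constructor
  · filter_upwards [hF.1, hH.1] with s h1 h2
    rw [h1, h2]; push_cast; ring
  · filter_upwards [hF.2, hH.2] with s h1 h2
    rw [h1, h2]; push_cast; ring

theorem HasSlopes.neg {F : ℝ → ℝ} {t : ℝ} {r l : ℤ} (hF : HasSlopes F t r l) :
    HasSlopes (fun x => - F x) t (-r) (-l) := by
  constructor
  · filter_upwards [hF.1] with s h1
    rw [h1]; push_cast; ring
  · filter_upwards [hF.2] with s h1
    rw [h1]; push_cast; ring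

theorem hasSlopes_affine (c : ℝ) (m : ℤ) (t : ℝ) : HasSlopes (fun x => c + m * x) t m (-m) := by
  constructor <;> refine Eventually.of_forall fun s => ?_ <;> push_cast <;> ring

/-- Opposite outward slopes mean that there is no bend at `t`, so the two one-sided expressions
merge into one affine function on a full neighbourhood. -/
theorem HasSlopes.eventually_eq {F : ℝ → ℝ} {t : ℝ} {m : ℤ} (h : HasSlopes F t m (-m)) :
    ∀ᶠ x in 𝓝 t, F x = F t + m * (x - t) := by
  obtain ⟨ε, hε, h1⟩ := eventually_nhdsGT_zero_iff.1 h.1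
  obtain ⟨δ, hδ, h2⟩ := eventually_nhdsGT_zero_iff.1 h.2
  filter_upwards [Ioo_mem_nhds (show t - δ < t by linarith) (show t < t + ε by linarith)]
    with x hx
  rcases lt_trichotomy x t with hxt | rfl | hxt
  · have := h2 (t - x) (by linarith) (by linarith [hx.1])
    rw [sub_sub_cancel] at this
    rw [this]; push_cast; ring
  · simp
  · have := h1 (x - t) (by linarith) (by linarith [hx.2])
    rwa [add_sub_cancel] at this

/-- A function that is locally affine on an interval is affine there. -/
theorem exists_affine_of_hasSlopes {F : ℝ → ℝ} {I : Set ℝ} (hI : IsOpen I)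
    (hI' : IsPreconnected I) (hne : I.Nonempty) (h : ∀ t ∈ I, ∃ m : ℤ, HasSlopes F t m (-m)) :
    ∃ (c : ℝ) (m : ℤ), ∀ t ∈ I, F t = c + m * t := by
  have hd : ∀ t (m : ℤ), (∀ᶠ x in 𝓝 t, F x = F t + m * (x - t)) → HasDerivAt F m t := by
    intro t m hm
    have : HasDerivAt (fun x => F t + m * (x - t)) (m : ℝ) t := by
      simpa using (((hasDerivAt_id t).sub_const t).const_mul (m : ℝ)).const_add (F t)
    exact this.congr_of_eventuallyEq hm
  -- The derivative is locally a constant integer, so it is itself differentiable with derivative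
  -- zero; preconnectedness of `I` then makes it globally constant.
  have hdd : ∀ t ∈ I, ∃ m : ℤ, deriv F t = m ∧ deriv F =ᶠ[𝓝 t] fun _ => (m : ℝ) := by
    intro t ht
    obtain ⟨m, hm⟩ := h t ht
    have hm := hm.eventually_eq
    refine ⟨m, (hd t m hm).deriv, ?_⟩
    filter_upwards [eventually_eventually_nhds.2 hm, hm] with x hx hx'
    refine (hd x m ?_).deriv
    filter_upwards [hx] with y hy
    rw [hy, hx']; ring
  obtain ⟨t₀, ht₀⟩ := hne
  obtain ⟨m, hm, -⟩ := hdd t₀ ht₀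
  have hconst : ∀ t ∈ I, deriv F t = m := by
    intro t ht
    rw [← hm]
    refine hI.is_const_of_deriv_eq_zero hI' (f := deriv F) (fun x hx => ?_) (fun x hx => ?_) ht ht₀
    · obtain ⟨n, -, hn⟩ := hdd x hx
      exact (hn.differentiableAt_iff.2 (differentiableAt_const _)).differentiableWithinAt
    · obtain ⟨n, -, hn⟩ := hdd x hx
      simpa using hn.deriv_eq
  have hF : ∀ t ∈ I, HasDerivAt F m t := by
    intro t ht
    obtain ⟨n, hn⟩ := h t ht
    have h1 := hd t n hn.eventually_eq
    rw [← hconst t ht]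
    exact h1.differentiableAt.hasDerivAt
  have hF' : ∀ t ∈ I, HasDerivAt (fun x => F x - m * x) 0 t := fun t ht => by
    simpa using (hF t ht).fun_sub ((hasDerivAt_id t).const_mul (m : ℝ))
  obtain ⟨c, hc⟩ := hI.exists_is_const_of_deriv_eq_zero hI'
    (fun t ht => (hF' t ht).differentiableAt.differentiableWithinAt) fun t ht => (hF' t ht).deriv
  exact ⟨c, m, fun t ht => by linarith [hc t ht]⟩

/-- The convex piecewise affine function `∑ aᵤ max(0, t - u)`. -/
noncomputable def kink (a : ℝ →₀ ℤ) (t : ℝ) : ℝ := a.sum fun u n => n * max 0 (t - u)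

/-- The sum `∑ aᵤ`. -/
noncomputable def mass (a : ℝ →₀ ℤ) : ℤ := a.sum fun _ n => n

/-- The first moment `∑ aᵤ u`. -/
noncomputable def moment (a : ℝ →₀ ℤ) : ℝ := a.sum fun u n => n * u

theorem kink_add (a b : ℝ →₀ ℤ) (t : ℝ) : kink (a + b) t = kink a t + kink b t :=
  Finsupp.sum_add_index' (by simp) fun _ _ _ => by push_cast; ring

theorem mass_add (a b : ℝ →₀ ℤ) : mass (a + b) = mass a + mass b :=
  Finsupp.sum_add_index' (by simp) fun _ _ _ => rfl

theorem moment_add (a b : ℝ →₀ ℤ) : moment (a + b) = moment a + moment b :=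
  Finsupp.sum_add_index' (by simp) fun _ _ _ => by push_cast; ring

theorem mass_zero : mass 0 = 0 := Finsupp.sum_zero_index

theorem moment_zero : moment 0 = 0 := Finsupp.sum_zero_index

theorem mass_single (u : ℝ) (n : ℤ) : mass (Finsupp.single u n) = n :=
  Finsupp.sum_single_index (by simp)

theorem moment_single (u : ℝ) (n : ℤ) : moment (Finsupp.single u n) = n * u :=
  Finsupp.sum_single_index (by simp)

theorem kink_of_le {a : ℝ →₀ ℤ} {t : ℝ} (h : ∀ u ∈ a.support, t ≤ u) : kink a t = 0 :=
  Finset.sum_eq_zero fun u hu => by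
    simp only [max_eq_left (sub_nonpos.2 (h u hu)), mul_zero]

/-- Beyond all bends each maximum is on its linear branch. This is how `mass` and `moment` enter the
values and slopes at the far end of an edge or leaf. -/
theorem kink_of_ge {a : ℝ →₀ ℤ} {t : ℝ} (h : ∀ u ∈ a.support, u ≤ t) :
    kink a t = mass a * t - moment a := by
  simp only [kink, mass, moment, Finsupp.sum]
  rw [Int.cast_sum, Finset.sum_mul, ← Finset.sum_sub_distrib]
  refine Finset.sum_congr rfl fun u hu => ?_
  rw [max_eq_right (sub_nonneg.2 (h u hu))]; ring

open Classical in
theorem exists_hasSlopes_kink_single (u : ℝ) (n : ℤ) (t : ℝ) :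
    ∃ r l, HasSlopes (kink (Finsupp.single u n)) t r l ∧ r + l = Finsupp.single u n t := by
  have hk : kink (Finsupp.single u n) = fun t => n * max 0 (t - u) := by
    funext t
    exact Finsupp.sum_single_index (by simp)
  rw [hk]
  rcases lt_trichotomy t u with h | rfl | h
  · refine ⟨0, 0, ⟨?_, ?_⟩, by simp [h.ne']⟩
    · filter_upwards [eventually_pos_lt (sub_pos.2 h)] with s hs
      rw [max_eq_left (by linarith), max_eq_left (by linarith)]; simp
    · filter_upwards [eventually_pos_lt (sub_pos.2 h)] with s hs
      rw [max_eq_left (by linarith), max_eq_left (by linarith)]; simp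
  · refine ⟨n, 0, ⟨?_, ?_⟩, by simp⟩
    · filter_upwards [eventually_pos_lt one_pos] with s hs
      rw [max_eq_right (by linarith), max_eq_left (by linarith)]; ring
    · filter_upwards [eventually_pos_lt one_pos] with s hs
      rw [max_eq_left (by linarith), max_eq_left (by linarith)]; simp
  · refine ⟨n, -n, ⟨?_, ?_⟩, by simp [h.ne]⟩
    · filter_upwards [eventually_pos_lt (sub_pos.2 h)] with s hs
      rw [max_eq_right (by linarith), max_eq_right (by linarith)]; ring
    · filter_upwards [eventually_pos_lt (sub_pos.2 h)] with s hs
      rw [max_eq_right (by linarith), max_eq_right (by linarith)]; push_cast; ring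

theorem exists_hasSlopes_kink (a : ℝ →₀ ℤ) (t : ℝ) :
    ∃ r l, HasSlopes (kink a) t r l ∧ r + l = a t := by
  induction a using Finsupp.induction_linear with
  | zero =>
    have : kink 0 = fun t => (0 : ℝ) + (0 : ℤ) * t := by
      funext t; simp [kink]
    exact ⟨0, -0, this ▸ hasSlopes_affine 0 0 t, by simp⟩
  | add a b ha hb =>
    obtain ⟨r, l, h, e⟩ := ha
    obtain ⟨r', l', h', e'⟩ := hb
    have : kink (a + b) = fun t => kink a t + kink b t := funext fun t => kink_add a b t
    exact ⟨r + r', l + l', this ▸ h.add h', by rw [Finsupp.add_apply, ← e, ← e']; ring⟩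
  | single u n => exact exists_hasSlopes_kink_single u n t

/-- A piecewise affine function on an interval is determined by its bends up to an affine
function. -/
theorem exists_eq_add_kink {F : ℝ → ℝ} {a : ℝ →₀ ℤ} {I : Set ℝ} (hI : IsOpen I)
    (hI' : IsPreconnected I) (hne : I.Nonempty)
    (h : ∀ t ∈ I, ∃ r l, HasSlopes F t r l ∧ r + l = a t) :
    ∃ (c : ℝ) (m : ℤ), ∀ t ∈ I, F t = c + m * t + kink a t := by
  -- Subtracting `kink a` cancels all bends, so the two outward slopes become opposite.
  obtain ⟨c, m, hc⟩ := exists_affine_of_hasSlopes (F := fun t => F t + - kink a t) hI hI' hne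
    fun t ht => by
      obtain ⟨r, l, h1, e1⟩ := h t ht
      obtain ⟨r', l', h2, e2⟩ := exists_hasSlopes_kink a t
      refine ⟨r + -r', ?_⟩
      have := h1.add h2.neg
      rwa [show l + -l' = -(r + -r') by omega] at this
  exact ⟨c, m, fun t ht => by linarith [hc t ht]⟩

theorem exists_hasSlopes_add_kink (c : ℝ) (m : ℤ) (a : ℝ →₀ ℤ) (t : ℝ) :
    ∃ r l, HasSlopes (fun t => c + m * t + kink a t) t r l ∧ r + l = a t := by
  obtain ⟨r, l, h, e⟩ := exists_hasSlopes_kink a t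
  exact ⟨_, _, (hasSlopes_affine c m t).add h, by rw [← e]; ring⟩

theorem eventually_kink_eq_zero {a : ℝ →₀ ℤ} (h : ∀ u ∈ a.support, 0 < u) :
    ∀ᶠ s in 𝓝[>] (0 : ℝ), kink a s = 0 := by
  have : ∀ᶠ s in 𝓝[>] (0 : ℝ), ∀ u ∈ a.support, s ≤ u := by
    rw [Finset.eventually_all]
    intro u hu
    filter_upwards [eventually_pos_lt (h u hu)] with s hs using hs.2.le
  filter_upwards [this] with s hs using kink_of_le hs

theorem eventually_kink_sub_eq {a : ℝ →₀ ℤ} {c : ℝ} (h : ∀ u ∈ a.support, u < c) :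
    ∀ᶠ s in 𝓝[>] (0 : ℝ), kink a (c - s) = mass a * (c - s) - moment a := by
  have : ∀ᶠ s in 𝓝[>] (0 : ℝ), ∀ u ∈ a.support, u ≤ c - s := by
    rw [Finset.eventually_all]
    intro u hu
    filter_upwards [eventually_pos_lt (sub_pos.2 (h u hu))] with s hs
    linarith
  filter_upwards [this] with s hs using kink_of_ge hs

theorem eventually_atTop_kink_eq (a : ℝ →₀ ℤ) :
    ∀ᶠ t in atTop, kink a t = mass a * t - moment a := by
  have : ∀ᶠ t in (atTop : Filter ℝ), ∀ u ∈ a.support, u ≤ t := by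
    rw [Finset.eventually_all]
    exact fun u _ => eventually_ge_atTop u
  filter_upwards [this] with s hs using kink_of_ge hs

variable {G : TropicalCurve.{u}}

/-! ### Divisors and isomorphism of line bundles -/

namespace LineBundle

/-- A rational section with divisor `D` identifies a line bundle with `L(D)`. -/
theorem HasDivisor.iso_ofDivisor {A : G.LineBundle} {D : G.Divisor} (h : A.HasDivisor D) :
    A.Iso (ofDivisor D) := by
  obtain ⟨s, h1, h2, h3⟩ := h
  -- The local expressions of the section and the local equations of `D` have the same orders, so
  -- their differences are affine and serve as the isomorphism.
  refine ⟨fun i k x => s i x + - k.1.2 x, fun i k => ?_, fun i j k x hx => ?_,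
    fun i k l x hx => ?_⟩
  · have hi := (h1 i).mono (W := A.U i ∩ (ofDivisor D).U k) Set.inter_subset_left
    have hk : RationalOn k.1.2 (A.U i ∩ (ofDivisor D).U k) :=
      RationalOn.mono k.2.2.1 Set.inter_subset_right
    refine ⟨hi.add hk.neg, fun p hp => ?_⟩
    rw [hi.ord_add hk.neg hp, hk.ord_neg hp, h3 i p hp.1, k.2.2.2 p hp.2, add_neg_cancel]
  · have := h2 i j x hx.1
    simp only
    linarith
  · simp only [ofDivisor]; ring

end LineBundle

/-- Needed for gluing: a global function defined through an arbitrary chart at each point agrees on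
every chart domain with a local expression, and inherits its slopes. -/
theorem RationalOn.congr {f g : G.FinPoint → ℝ} {U : Set G.Point} (hU : IsOpen U)
    (hfg : ∀ x, Point.fin x ∈ U → f x = g x) (hf : RationalOn f U) :
    RationalOn g U ∧ ∀ p ∈ U, ord g p = ord f p := by
  refine ⟨fun p hp τ hτ => ?_, fun p hp => Finset.sum_congr rfl fun τ hτ => ?_⟩
  · obtain ⟨m, hm⟩ := hf p hp τ hτ
    exact ⟨m, hm.congr hU hp hτ hfg⟩
  · obtain ⟨m, hm⟩ := hf p hp τ hτ
    rw [(hm.congr hU hp hτ hfg).slope_eq, hm.slope_eq]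

/-- A divisor is principal if it is the divisor of a global rational function. -/
def IsPrincipal (D : G.Divisor) : Prop := ∃ f, RationalOn f Set.univ ∧ ∀ p, ord f p = D p

namespace LineBundle

/-- Two rational sections of a line bundle differ by a rational function. -/
theorem HasDivisor.isPrincipal_sub {A : G.LineBundle} {D D' : G.Divisor} (h : A.HasDivisor D)
    (h' : A.HasDivisor D') : IsPrincipal (D - D') := by
  obtain ⟨s, h1, h2, h3⟩ := h
  obtain ⟨s', h1', h2', h3'⟩ := h'
  -- The chart `k x` is arbitrary; the transition functions cancel in the difference of two
  -- sections, so the result does not depend on it.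
  choose k hk using fun x => A.covers (Point.fin x)
  have key : ∀ i x, Point.fin x ∈ A.U i → s i x + - s' i x = s (k x) x + - s' (k x) x := by
    intro i x hx
    rw [h2 i (k x) x ⟨hx, hk x⟩, h2' i (k x) x ⟨hx, hk x⟩]; ring
  have loc := fun i => RationalOn.congr (A.isOpen_U i) (key i) ((h1 i).add (h1' i).neg)
  refine ⟨fun x => s (k x) x + - s' (k x) x, fun p _ => ?_, fun p => ?_⟩
  · obtain ⟨i, hi⟩ := A.covers p
    exact (loc i).1 p hi
  · obtain ⟨i, hi⟩ := A.covers p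
    rw [(loc i).2 p hi, (h1 i).ord_add (h1' i).neg hi, (h1' i).ord_neg hi, h3 i p hi, h3' i p hi,
      Finsupp.sub_apply, sub_eq_add_neg]

theorem HasDivisor.add_isPrincipal {A : G.LineBundle} {D E : G.Divisor} (h : A.HasDivisor D)
    (h' : IsPrincipal E) : A.HasDivisor (D + E) := by
  obtain ⟨s, h1, h2, h3⟩ := h
  obtain ⟨f, hf, hE⟩ := h'
  have hf' : ∀ i, RationalOn f (A.U i) := fun i => hf.mono (Set.subset_univ _)
  refine ⟨fun i x => s i x + f x, fun i => (h1 i).add (hf' i), fun i j x hx => ?_,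
    fun i p hp => ?_⟩
  · have := h2 i j x hx
    simp only
    linarith
  · rw [(h1 i).ord_add (hf' i) hp, h3 i p hp, hE, Finsupp.add_apply]

/-- The transported section is `s j - g j k` in the chart `k` of `B`; it is independent of the chart
`j` of `A`, and subtracting an affine function leaves the orders unchanged. -/
theorem HasDivisor.of_iso {A B : G.LineBundle} {D : G.Divisor} (h : A.HasDivisor D)
    (hAB : A.Iso B) : B.HasDivisor D := by
  obtain ⟨s, h1, h2, h3⟩ := h
  obtain ⟨g, g1, g2, g3⟩ := hAB
  choose i hi using fun x => A.covers (Point.fin x)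
  have key : ∀ j k x, Point.fin x ∈ A.U j ∩ B.U k →
      s j x + - g j k x = s (i x) x + - g (i x) k x := by
    intro j k x hx
    rw [h2 j (i x) x ⟨hx.1, hi x⟩, g2 j (i x) k x ⟨⟨hx.1, hi x⟩, hx.2⟩]; ring
  have hs := fun j k => (h1 j).mono (W := A.U j ∩ B.U k) Set.inter_subset_left
  have loc := fun j k => RationalOn.congr ((A.isOpen_U j).inter (B.isOpen_U k)) (key j k)
    ((hs j k).add (g1 j k).1.neg)
  refine ⟨fun k x => s (i x) x + - g (i x) k x, fun k p hp => ?_, fun k l x hx => ?_,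
    fun k p hp => ?_⟩
  · obtain ⟨j, hj⟩ := A.covers p
    exact (loc j k).1 p ⟨hj, hp⟩
  · have := g3 (i x) k l x ⟨⟨hi x, hx.1⟩, hx.2⟩
    linarith
  · obtain ⟨j, hj⟩ := A.covers p
    rw [(loc j k).2 p ⟨hj, hp⟩, (hs j k).ord_add (g1 j k).1.neg ⟨hj, hp⟩,
      (g1 j k).1.ord_neg ⟨hj, hp⟩, (g1 j k).2 p ⟨hj, hp⟩, h3 j p hj, neg_zero, add_zero]

end LineBundle

/-- The degree of a class is defined through a section with a divisor of that degree, and this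
section identifies the bundle with the one of the divisor. -/
theorem PicDeg.ofDivisor_surjective (d : ℤ) :
    Function.Surjective (PicDeg.ofDivisor : G.DivDeg d → G.PicDeg d) := by
  rintro ⟨_, A, rfl, D, hD, hd⟩
  exact ⟨⟨D, hd⟩, Subtype.ext (Quotient.sound hD.iso_ofDivisor.symm)⟩

/-- Two divisors define isomorphic line bundles if and only if they are linearly equivalent. -/
theorem PicDeg.ofDivisor_eq_iff {d : ℤ} (D D' : G.DivDeg d) :
    PicDeg.ofDivisor D = PicDeg.ofDivisor D' ↔ IsPrincipal (D.1 - D'.1) := by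
  refine Iff.trans (Subtype.ext_iff.trans Quotient.eq) ?_
  constructor
  · intro h
    exact ((LineBundle.hasDivisor_ofDivisor D.1).of_iso h).isPrincipal_sub
      (LineBundle.hasDivisor_ofDivisor D'.1)
  · intro h
    have := ((LineBundle.hasDivisor_ofDivisor D'.1).add_isPrincipal h).iso_ofDivisor
    rw [add_sub_cancel] at this
    exact this.symm

/-! ### Sums over tangent directions -/

-- A loop at `v` contributes two tangent directions, so each edge has a separate term for each of
-- its ends.
open Classical in
theorem sum_tangents_vertex {M : Type*} [AddCommMonoid M] (g : G.Dir → M) (v : G.V) :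
    ∑ τ ∈ tangents (.fin (.vertex v)), g τ =
      ∑ e, ((if G.src e = v then g (.inl (e, true)) else 0) +
        if G.tgt e = v then g (.inl (e, false)) else 0) +
      ∑ l, if G.root l = v then g (.inr (l, true)) else 0 := by
  rw [tangents, Finset.sum_filter, Fintype.sum_sum_type, Fintype.sum_prod_type,
    Fintype.sum_prod_type]
  simp only [Fintype.sum_bool]
  refine congrArg₂ HAdd.hAdd rfl (Finset.sum_congr rfl fun l _ => ?_)
  exact (congrArg₂ HAdd.hAdd rfl (if_neg id)).trans (add_zero _)

theorem sum_tangents_edge {M : Type*} [AddCommMonoid M] (g : G.Dir → M) (e : G.E) (t : ℝ)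
    (h₀ : 0 < t) (h₁ : t < G.len e) :
    ∑ τ ∈ tangents (.fin (.edge e t h₀ h₁)), g τ = g (.inl (e, true)) + g (.inl (e, false)) := by
  classical
  rw [tangents_edge, Finset.sum_pair (by simp)]

theorem sum_tangents_leaf {M : Type*} [AddCommMonoid M] (g : G.Dir → M) (l : G.L) (t : ℝ)
    (h₀ : 0 < t) :
    ∑ τ ∈ tangents (.fin (.leaf l t h₀)), g τ = g (.inr (l, true)) + g (.inr (l, false)) := by
  classical
  rw [tangents_leaf, Finset.sum_pair (by simp)]

theorem sum_tangents_infty {M : Type*} [AddCommMonoid M] (g : G.Dir → M) (l : G.L) :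
    ∑ τ ∈ tangents (.infty l), g τ = g (.inr (l, false)) := by
  rw [tangents_infty, Finset.sum_singleton]

/-! ### One-forms and duality -/

/-- Integration along an integral chain of edges. -/
noncomputable def chainIntegral (n : G.E → ℤ) : Module.Dual ℝ G.Form :=
  ∑ e, n e • (G.len e • Form.eval (.inl (e, true)))

theorem chainIntegral_add (n m : G.E → ℤ) :
    chainIntegral (n + m) = chainIntegral n + chainIntegral m := by
  simp [chainIntegral, add_smul, Finset.sum_add_distrib]

theorem chainIntegral_neg (n : G.E → ℤ) : chainIntegral (-n) = - chainIntegral n := by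
  simp [chainIntegral]

theorem chainIntegral_zero : chainIntegral (0 : G.E → ℤ) = 0 := by
  simp [chainIntegral]

open Classical in
/-- The boundary of a chain of edges. -/
noncomputable def edgeBoundary {R : Type*} [Ring R] (n : G.E → R) (v : G.V) : R :=
  ∑ e, ((if G.tgt e = v then n e else 0) - if G.src e = v then n e else 0)

theorem edgeBoundary_add {R : Type*} [Ring R] (n m : G.E → R) (v : G.V) :
    edgeBoundary (n + m) v = edgeBoundary n v + edgeBoundary m v := by
  rw [edgeBoundary, edgeBoundary, edgeBoundary, ← Finset.sum_add_distrib]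
  refine Finset.sum_congr rfl fun e _ => ?_
  simp only [Pi.add_apply]
  split_ifs <;> abel

theorem edgeBoundary_smul {R : Type*} [Ring R] (c : R) (n : G.E → R) (v : G.V) :
    edgeBoundary (c • n) v = c * edgeBoundary n v := by
  rw [edgeBoundary, edgeBoundary, Finset.mul_sum]
  refine Finset.sum_congr rfl fun e _ => ?_
  simp only [Pi.smul_apply, smul_eq_mul]
  split_ifs <;> simp

theorem boundary_inl (c : G.E ⊕ G.L → ℤ) (v : G.V) [DecidableEq G.V] :
    G.boundary c (.inl v) = edgeBoundary (fun e => c (.inl e)) v -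
      ∑ l, if G.root l = v then c (.inr l) else 0 := by
  simp only [boundary, Fintype.linearCombination_apply, Fintype.sum_sum_type, Finset.sum_apply,
    Sum.elim_inl, Sum.elim_inr, Pi.smul_apply, Pi.sub_apply, edgeBoundary,
    sub_eq_add_neg (a := Finset.sum _ _), ← Finset.sum_neg_distrib]
  congr 1
  · refine Finset.sum_congr rfl fun e _ => ?_
    simp only [Pi.single_apply, Sum.inl.injEq, smul_eq_mul, mul_sub, mul_ite, mul_one, mul_zero,
      eq_comm (a := v)]
  · refine Finset.sum_congr rfl fun l _ => ?_
    simp only [Pi.single_apply, Sum.inl.injEq, smul_eq_mul, reduceCtorEq, if_false, eq_comm (a := v)]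
    split_ifs <;> simp

/-- Only the leaf `l` reaches its endpoint, so cycles have no leaf components and H₁ consists of
closed chains of edges. -/
theorem boundary_inr (c : G.E ⊕ G.L → ℤ) (l : G.L) : G.boundary c (.inr l) = c (.inr l) := by
  classical
  simp [boundary, Fintype.linearCombination_apply, Fintype.sum_sum_type, Finset.sum_apply,
    Pi.single_apply]

/-- The periods are the integrals along closed chains of edges. -/
theorem mem_range_period_iff {u : Module.Dual ℝ G.Form} :
    u ∈ G.period.range ↔ ∃ n : G.E → ℤ, (∀ v, edgeBoundary n v = 0) ∧ chainIntegral n = u := by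
  classical
  constructor
  · rintro ⟨c, rfl⟩
    have hc : G.boundary c.1 = 0 := c.2
    have hl : ∀ l, c.1 (.inr l) = 0 := fun l => by
      rw [← boundary_inr c.1, hc]; rfl
    refine ⟨fun e => c.1 (.inl e), fun v => ?_, rfl⟩
    have := boundary_inl c.1 v
    simpa [hc, hl] using this.symm
  · rintro ⟨n, hn, rfl⟩
    refine ⟨⟨Sum.elim n 0, ?_⟩, rfl⟩
    rw [LinearMap.mem_ker]
    funext x
    rcases x with v | l
    · simpa [boundary_inl] using hn v
    · simp [boundary_inr]

/-- The form with given closed real values on the edges. -/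
noncomputable def formOfChain (x : G.E → ℝ) (hx : ∀ v, edgeBoundary x v = 0) : G.Form :=
  ⟨Sum.elim (fun τ => if τ.2 then x τ.1 else - x τ.1) 0, by simp, by simp, by
    classical
    rintro ((⟨v⟩ | ⟨e, t, h₀, h₁⟩ | ⟨l, t, h₀⟩) | ⟨l⟩)
    · have := hx v
      rw [edgeBoundary, ← neg_eq_zero, ← Finset.sum_neg_distrib] at this
      rw [sum_tangents_vertex]
      simp only [Sum.elim_inl, Sum.elim_inr, Pi.zero_apply, ite_self, Finset.sum_const_zero,
        add_zero]
      refine (Finset.sum_congr rfl fun e _ => ?_).trans this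
      by_cases h1 : G.src e = v <;> by_cases h2 : G.tgt e = v <;> simp [h1, h2]
    · simp [sum_tangents_edge]
    · simp [sum_tangents_leaf]
    · simp [sum_tangents_infty]⟩

/-- Balancing at `v` is closedness at `v` up to sign, the leaf terms being zero. Together with
`formOfChain` this matches forms with closed real edge chains. -/
theorem form_edgeBoundary (ω : G.Form) (v : G.V) :
    edgeBoundary (fun e => ω.1 (.inl (e, true))) v = 0 := by
  classical
  have := ω.2.2.2 (.fin (.vertex v))
  rw [sum_tangents_vertex] at this
  simp only [Form.leaf_eq_zero, ite_self, Finset.sum_const_zero, add_zero, ω.2.1] at this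
  rw [edgeBoundary, ← neg_eq_zero, ← Finset.sum_neg_distrib]
  refine (Finset.sum_congr rfl fun e _ => ?_).trans this
  by_cases h1 : G.src e = v <;> by_cases h2 : G.tgt e = v <;> simp [h1, h2]

theorem sum_smul_eval_apply (a : G.E → ℝ) (ω : G.Form) :
    (∑ e, a e • Form.eval (.inl (e, true))) ω = ∑ e, a e * ω.1 (.inl (e, true)) := by
  simp [LinearMap.sum_apply, Form.eval]

/-- Coboundaries are exactly the functionals on chains that vanish on forms. -/
theorem sum_smul_eval_eq_zero_iff (a : G.E → ℝ) :
    ∑ e, a e • Form.eval (G := G) (.inl (e, true)) = 0 ↔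
      ∃ φ : G.V → ℝ, ∀ e, a e = φ (G.tgt e) - φ (G.src e) := by
  classical
  -- Summation by parts: the boundary of edge chains is adjoint to the coboundary of vertex
  -- functions.
  have hsum : ∀ (φ : G.V → ℝ) (x : G.E → ℝ),
      ∑ v, edgeBoundary x v * φ v = ∑ e, (φ (G.tgt e) - φ (G.src e)) * x e := by
    intro φ x
    simp only [edgeBoundary, Finset.sum_mul]
    rw [Finset.sum_comm]
    refine Finset.sum_congr rfl fun e _ => ?_
    simp only [sub_mul, ite_mul, zero_mul, Finset.sum_sub_distrib, Finset.sum_ite_eq,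
      Finset.mem_univ, if_true]
    ring
  constructor
  · intro h
    let B : (G.E → ℝ) →ₗ[ℝ] (G.V → ℝ) :=
      { toFun := edgeBoundary
        map_add' := fun x y => funext fun v => edgeBoundary_add x y v
        map_smul' := fun c x => funext fun v => edgeBoundary_smul c x v }
    let A : Module.Dual ℝ (G.E → ℝ) := ∑ e, a e • LinearMap.proj e
    have hA : ∀ x, A x = ∑ e, a e * x e := fun x => by simp [A, LinearMap.sum_apply]
    -- In finite dimension, a functional that vanishes on the kernel of the boundary `B` factors
    -- through `B`; the values of the factor on the vertex basis are the potential.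
    have hmem : A ∈ (LinearMap.ker B).dualAnnihilator := by
      rw [Submodule.mem_dualAnnihilator]
      intro x hx
      have := sum_smul_eval_apply a (formOfChain x fun v => congrFun (LinearMap.mem_ker.1 hx) v)
      rw [h] at this
      rw [hA]
      simpa [formOfChain] using this.symm
    rw [← LinearMap.range_dualMap_eq_dualAnnihilator_ker] at hmem
    obtain ⟨ψ, hψ⟩ := hmem
    refine ⟨fun v => ψ (Pi.single v 1), fun e => ?_⟩
    have h1 : A (Pi.single e 1) = a e := by simp [hA, Pi.single_apply]
    rw [← h1, ← hψ, LinearMap.dualMap_apply, LinearMap.pi_apply_eq_sum_univ]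
    have := hsum (fun v => ψ (Pi.single v 1)) (Pi.single e 1)
    simp only [Pi.single_apply, mul_ite, mul_one, mul_zero, Finset.sum_ite_eq', Finset.mem_univ,
      if_true] at this
    rw [← this]
    refine Finset.sum_congr rfl fun v _ => ?_
    rw [smul_eq_mul]
    congr 2
    funext w
    simp [Pi.single_apply, eq_comm]
  · rintro ⟨φ, hφ⟩
    ext ω
    rw [sum_smul_eval_apply, LinearMap.zero_apply]
    simp only [hφ]
    rw [← hsum φ]
    simp [form_edgeBoundary]

/-- The functionals on forms are the real chains of edges. -/
theorem exists_eq_sum_smul_eval (u : Module.Dual ℝ G.Form) :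
    ∃ a : G.E → ℝ, u = ∑ e, a e • Form.eval (.inl (e, true)) := by
  classical
  -- Extend the functional from forms to all functions on directions. On forms the two orientations
  -- of an edge combine with opposite signs, and leaves drop out.
  obtain ⟨w, rfl⟩ := Subspace.dualRestrict_surjective (W := G.Form) u
  refine ⟨fun e => w (Pi.single (.inl (e, true)) 1) - w (Pi.single (.inl (e, false)) 1), ?_⟩
  ext ω
  rw [sum_smul_eval_apply, Submodule.dualRestrict_apply, LinearMap.pi_apply_eq_sum_univ]
  have hs : ∀ τ : G.Dir, (fun j => if τ = j then (1 : ℝ) else 0) = Pi.single τ 1 := by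
    intro τ; funext j; simp [Pi.single_apply, eq_comm]
  simp only [Fintype.sum_sum_type, Fintype.sum_prod_type, Fintype.sum_bool,
    Form.leaf_eq_zero, ω.2.1, smul_eq_mul, zero_mul, add_zero, Finset.sum_const_zero, hs]
  refine Finset.sum_congr rfl fun e _ => ?_
  ring

/-! ### Integrals along paths -/

theorem edgePt_of_mem {e : G.E} {t : ℝ} (h₀ : 0 < t) (h₁ : t < G.len e) :
    edgePt e t = .edge e t h₀ h₁ := by
  simp [edgePt, h₀, h₁]

theorem leafPt_of_pos {l : G.L} {t : ℝ} (h₀ : 0 < t) : leafPt l t = .leaf l t h₀ := by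
  simp [leafPt, h₀]

/-- The starting vertex of the edge or leaf containing a point. -/
def baseVertex : G.Point → G.V
  | .fin (.vertex v) => v
  | .fin (.edge e _ _ _) => G.src e
  | .fin (.leaf l _ _) => G.root l
  | .infty l => G.root l

open Classical in
/-- The indicator function of the starting vertex of the edge or leaf containing a point. -/
noncomputable def baseIndicator (v : G.V) (p : G.Point) : ℤ := if baseVertex p = v then 1 else 0

open Classical in
theorem baseIndicator_vertex (v w : G.V) :
    baseIndicator v (.fin (.vertex w)) = if w = v then 1 else 0 := rfl

open Classical in
theorem baseIndicator_edge (v : G.V) (e : G.E) (t : ℝ) (h₀ : 0 < t) (h₁ : t < G.len e) :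
    baseIndicator v (.fin (.edge e t h₀ h₁)) = if G.src e = v then 1 else 0 := rfl

open Classical in
theorem baseIndicator_leaf (v : G.V) (l : G.L) (t : ℝ) (h₀ : 0 < t) :
    baseIndicator v (.fin (.leaf l t h₀)) = if G.root l = v then 1 else 0 := rfl

open Classical in
theorem baseIndicator_infty (v : G.V) (l : G.L) :
    baseIndicator v (.infty l) = if G.root l = v then 1 else 0 := rfl

/-- The integral from the starting vertex of the edge or leaf containing a point to the point. -/
noncomputable def offset : G.Point → Module.Dual ℝ G.Form
  | .fin (.edge e t _ _) => t • Form.eval (.inl (e, true))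
  | _ => 0

theorem eval_leaf (l : G.L) (b : Bool) : Form.eval (G := G) (.inr (l, b)) = 0 :=
  LinearMap.ext fun ω => Form.leaf_eq_zero ω l b

/-- At `s = len e` the point is a vertex, with offset zero and base vertex `tgt e` rather than `src
e`. There `k = 1` compensates by one whole edge; elsewhere `k = 0`. -/
theorem exists_offset_edgePt (e : G.E) {s : ℝ} (hs : s ∈ Set.Icc 0 (G.len e)) : ∃ k : ℤ,
    offset (.fin (edgePt e s)) = (s - k * G.len e) • Form.eval (.inl (e, true)) ∧
    ∀ v, baseIndicator v (.fin (edgePt e s)) =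
      baseIndicator v (.fin (.vertex (G.src e))) + k *
        (baseIndicator v (.fin (.vertex (G.tgt e))) -
          baseIndicator v (.fin (.vertex (G.src e)))) := by
  rcases hs.1.eq_or_lt with rfl | h0
  · refine ⟨0, ?_, fun v => ?_⟩ <;> simp [edgePt_zero, offset]
  · rcases hs.2.eq_or_lt with rfl | h1
    · refine ⟨1, ?_, fun v => ?_⟩ <;> simp [edgePt_len, offset]
    · refine ⟨0, ?_, fun v => ?_⟩ <;> rw [edgePt_of_mem h0 h1]
      · simp [offset]
      · simp [baseIndicator_edge, baseIndicator_vertex]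

theorem offset_leafPt (l : G.L) (s : ℝ) : offset (.fin (leafPt l s)) = 0 := by
  rw [leafPt]; split_ifs <;> rfl

theorem baseVertex_leafPt (l : G.L) (s : ℝ) : baseVertex (.fin (leafPt l s)) = G.root l := by
  rw [leafPt]; split_ifs <;> rfl

theorem edgeBoundary_zero (v : G.V) : edgeBoundary (0 : G.E → ℤ) v = 0 := by simp [edgeBoundary]

theorem edgeBoundary_neg (n : G.E → ℤ) (v : G.V) : edgeBoundary (-n) v = - edgeBoundary n v := by
  rw [← neg_one_smul ℤ n, edgeBoundary_smul, neg_one_mul]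

theorem chainIntegral_smul (c : ℤ) (n : G.E → ℤ) :
    chainIntegral (c • n) = c • chainIntegral n := by
  simp only [chainIntegral, Finset.smul_sum, Pi.smul_apply, smul_eq_mul, mul_smul]

/-- Sliding both ends back to their base vertices turns the path into an integral chain of edges, at
the cost of the two offsets; leaves contribute nothing to integrals. -/
theorem Path.exists_integral_eq {p q : G.Point} (γ : Path p q) : ∃ n : G.E → ℤ,
    γ.integral = offset q - offset p + chainIntegral n ∧
    ∀ v, edgeBoundary n v = baseIndicator v q - baseIndicator v p := by
  classical
  induction γ with
  | refl p => exact ⟨0, by simp [Path.integral, chainIntegral_zero], by simp [edgeBoundary_zero]⟩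
  | edge e s t hs ht =>
    obtain ⟨k, h1, h2⟩ := exists_offset_edgePt e hs
    obtain ⟨k', h1', h2'⟩ := exists_offset_edgePt e ht
    refine ⟨Pi.single e (k' - k), ?_, fun v => ?_⟩
    · rw [h1, h1', chainIntegral, Finset.sum_eq_single e (fun b _ hb => by simp [hb]) (by simp),
        Path.integral, Pi.single_eq_same, ← Int.cast_smul_eq_zsmul ℝ]
      push_cast
      module
    · rw [h2, h2', edgeBoundary, Finset.sum_eq_single e (fun b _ hb => by simp [hb]) (by simp),
        Pi.single_eq_same]
      simp only [baseIndicator_vertex]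
      by_cases ha : G.tgt e = v <;> by_cases hb : G.src e = v <;> simp [ha, hb]
      ring
  | leaf l s t hs ht =>
    refine ⟨0, ?_, fun v => ?_⟩
    · simp [Path.integral, eval_leaf, offset_leafPt, chainIntegral_zero]
    · simp [edgeBoundary_zero, baseIndicator, baseVertex_leafPt]
  | ray l s hs =>
    refine ⟨0, ?_, fun v => ?_⟩
    · rw [offset_leafPt, show offset (.infty l) = 0 from rfl]
      simp [Path.integral, chainIntegral_zero]
    · rw [baseIndicator, baseIndicator, baseVertex_leafPt,
        show baseVertex (.infty l) = G.root l from rfl, sub_self, edgeBoundary_zero]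
  | symm γ h =>
    obtain ⟨n, h1, h2⟩ := h
    refine ⟨-n, ?_, fun v => ?_⟩
    · rw [Path.integral, h1, chainIntegral_neg]; abel
    · rw [edgeBoundary_neg, h2]; ring
  | trans γ δ h h' =>
    obtain ⟨n, h1, h2⟩ := h
    obtain ⟨m, h1', h2'⟩ := h'
    refine ⟨n + m, ?_, fun v => ?_⟩
    · rw [Path.integral, h1, h1', chainIntegral_add]; abel
    · rw [edgeBoundary_add, h2, h2']; ring

/-- The offsets cancel, and the two chains have the same boundary, so their difference is closed. -/
theorem Path.integral_sub_mem {p q : G.Point} (γ δ : Path p q) :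
    γ.integral - δ.integral ∈ G.period.range := by
  obtain ⟨n, h1, h2⟩ := γ.exists_integral_eq
  obtain ⟨m, h1', h2'⟩ := δ.exists_integral_eq
  refine mem_range_period_iff.2 ⟨n + -m, fun v => ?_, ?_⟩
  · rw [edgeBoundary_add, edgeBoundary_neg, h2, h2', add_neg_cancel]
  · rw [h1, h1', chainIntegral_add, chainIntegral_neg]; abel

theorem integralAlong_eq {p₀ : G.Point} (γ : ∀ p, Path p₀ p) (D : G.Divisor) :
    integralAlong γ D = Finsupp.linearCombination ℤ (fun p => (γ p).integral) D := rfl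

theorem Divisor.deg_eq (D : G.Divisor) :
    D.deg = Finsupp.linearCombination ℤ (fun _ : G.Point => (1 : ℤ)) D := by
  simp [Divisor.deg, Finsupp.linearCombination_apply]

/-- The class of `∑ aᵢ ∫_{p₀}^{pᵢ}` does not depend on the paths of integration. -/
theorem mk_integralAlong_eq {p₀ : G.Point} (γ δ : ∀ p, Path p₀ p) (D : G.Divisor) :
    (QuotientAddGroup.mk (integralAlong γ D) : G.Jacobian) =
      QuotientAddGroup.mk (integralAlong δ D) := by
  rw [QuotientAddGroup.eq, integralAlong, integralAlong, Finsupp.sum, Finsupp.sum,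
    ← Finset.sum_neg_distrib, ← Finset.sum_add_distrib]
  refine sum_mem fun p _ => ?_
  have h := zsmul_mem ((δ p).integral_sub_mem (γ p)) (D p)
  rw [zsmul_sub] at h
  rw [neg_add_eq_sub]
  exact h

/-- The linear extension of `Path.exists_integral_eq`. The contributions of the base point are
multiplied by the degree, so they disappear in degree zero. -/
theorem exists_integralAlong_eq {p₀ : G.Point} (γ : ∀ p, Path p₀ p) (D : G.Divisor) :
    ∃ n : G.E → ℤ, integralAlong γ D =
      Finsupp.linearCombination ℤ offset D - D.deg • offset p₀ + chainIntegral n ∧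
    ∀ v, edgeBoundary n v =
      Finsupp.linearCombination ℤ (baseIndicator v) D - D.deg * baseIndicator v p₀ := by
  simp only [integralAlong_eq, Divisor.deg_eq]
  induction D using Finsupp.induction_linear with
  | zero => exact ⟨0, by simp [chainIntegral_zero], by simp [edgeBoundary_zero]⟩
  | add D D' h h' =>
    obtain ⟨n, h1, h2⟩ := h
    obtain ⟨m, h1', h2'⟩ := h'
    refine ⟨n + m, ?_, fun v => ?_⟩
    · simp only [map_add, h1, h1', chainIntegral_add, add_smul]; abel
    · simp only [map_add, edgeBoundary_add, h2, h2']; ring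
  | single p a =>
    obtain ⟨n, h1, h2⟩ := (γ p).exists_integral_eq
    refine ⟨a • n, ?_, fun v => ?_⟩
    · simp only [Finsupp.linearCombination_single, h1, chainIntegral_smul, smul_add, smul_sub,
        smul_eq_mul, mul_one]
    · simp only [Finsupp.linearCombination_single, edgeBoundary_smul, h2, smul_eq_mul, mul_one]
      ring

/-! ### Restriction of divisors to edges and leaves -/

open Classical in
/-- The coordinate of a point of the interior of the edge `e`. -/
noncomputable def edgeCoord (e : G.E) : G.Point → ℝ →₀ ℤ
  | .fin (.edge e' t _ _) => if e' = e then Finsupp.single t 1 else 0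
  | _ => 0

open Classical in
/-- The coordinate of a point of the interior of the leaf `l`. -/
noncomputable def leafCoord (l : G.L) : G.Point → ℝ →₀ ℤ
  | .fin (.leaf l' t _) => if l' = l then Finsupp.single t 1 else 0
  | _ => 0

/-- The restriction of a divisor to the interior of an edge. -/
noncomputable def edgePart (e : G.E) : G.Divisor →ₗ[ℤ] ℝ →₀ ℤ :=
  Finsupp.linearCombination ℤ (edgeCoord e)

/-- The restriction of a divisor to the interior of a leaf. -/
noncomputable def leafPart (l : G.L) : G.Divisor →ₗ[ℤ] ℝ →₀ ℤ :=
  Finsupp.linearCombination ℤ (leafCoord l)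

theorem edgePart_single (e : G.E) (p : G.Point) (n : ℤ) :
    edgePart e (Finsupp.single p n) = n • edgeCoord e p := by
  rw [edgePart, Finsupp.linearCombination_single]

theorem leafPart_single (l : G.L) (p : G.Point) (n : ℤ) :
    leafPart l (Finsupp.single p n) = n • leafCoord l p := by
  rw [leafPart, Finsupp.linearCombination_single]

open Classical in
theorem edgePart_apply (e : G.E) (D : G.Divisor) (t : ℝ) : edgePart e D t =
    if h : 0 < t ∧ t < G.len e then D (.fin (.edge e t h.1 h.2)) else 0 := by
  induction D using Finsupp.induction_linear with
  | zero => simp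
  | add D D' h h' =>
    rw [map_add, Finsupp.add_apply, h, h']
    split_ifs <;> simp
  | single p n =>
    rw [edgePart_single]
    rcases p with (⟨v⟩ | ⟨e', t', h₀, h₁⟩ | ⟨l, t', h₀⟩) | ⟨l⟩
    · simp [edgeCoord]
    · by_cases he : e' = e
      · subst he
        by_cases ht : t' = t
        · subst ht; simp [edgeCoord, h₀, h₁]
        · simp [edgeCoord, ht]
      · simp [edgeCoord, he]
    · simp [edgeCoord]
    · simp [edgeCoord]

open Classical in
theorem leafPart_apply (l : G.L) (D : G.Divisor) (t : ℝ) : leafPart l D t =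
    if h : 0 < t then D (.fin (.leaf l t h)) else 0 := by
  induction D using Finsupp.induction_linear with
  | zero => simp
  | add D D' h h' =>
    rw [map_add, Finsupp.add_apply, h, h']
    split_ifs <;> simp
  | single p n =>
    rw [leafPart_single]
    rcases p with (⟨v⟩ | ⟨e', t', h₀, h₁⟩ | ⟨l', t', h₀⟩) | ⟨l'⟩
    · simp [leafCoord]
    · simp [leafCoord]
    · by_cases he : l' = l
      · subst he
        by_cases ht : t' = t
        · subst ht; simp [leafCoord, h₀]
        · simp [leafCoord, ht]
      · simp [leafCoord, he]
    · simp [leafCoord]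

theorem mem_support_edgePart {e : G.E} {D : G.Divisor} {t : ℝ} (h : t ∈ (edgePart e D).support) :
    0 < t ∧ t < G.len e := by
  rw [Finsupp.mem_support_iff, edgePart_apply] at h
  by_contra hc
  exact h (dif_neg hc)

theorem mem_support_leafPart {l : G.L} {D : G.Divisor} {t : ℝ} (h : t ∈ (leafPart l D).support) :
    0 < t := by
  rw [Finsupp.mem_support_iff, leafPart_apply] at h
  by_contra hc
  exact h (dif_neg hc)

/-- Only interior points of edges have a nonzero offset, proportional to their coordinate. So the
moments in the increments of rational functions reappear in the integral of a divisor. -/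
theorem linearCombination_offset (D : G.Divisor) : Finsupp.linearCombination ℤ offset D =
    ∑ e, moment (edgePart e D) • Form.eval (.inl (e, true)) := by
  classical
  induction D using Finsupp.induction_linear with
  | zero => simp [moment_zero]
  | add D D' h h' => simp only [map_add, h, h', moment_add, add_smul, Finset.sum_add_distrib]
  | single p n =>
    simp only [Finsupp.linearCombination_single, edgePart_single]
    rcases p with (⟨v⟩ | ⟨e, t, h₀, h₁⟩ | ⟨l, t, h₀⟩) | ⟨l⟩
    · simp [offset, edgeCoord, moment_zero]
    · rw [Finset.sum_eq_single e (fun b _ hb => by simp [edgeCoord, hb.symm, moment_zero])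
        (by simp)]
      simp [edgeCoord, offset, moment_single, mul_smul, Int.cast_smul_eq_zsmul]
    · simp [offset, edgeCoord, moment_zero]
    · simp [offset, edgeCoord, moment_zero]

open Classical in
theorem linearCombination_baseIndicator (v : G.V) (D : G.Divisor) :
    Finsupp.linearCombination ℤ (baseIndicator v) D = D (.fin (.vertex v)) +
      ∑ e, (if G.src e = v then mass (edgePart e D) else 0) +
      ∑ l, if G.root l = v then mass (leafPart l D) + D (.infty l) else 0 := by
  induction D using Finsupp.induction_linear with
  | zero => simp [mass_zero]
  | add D D' h h' =>
    have h1 : ∀ (P : Prop) [Decidable P] (a b : ℤ), (if P then a + b else 0) =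
      (if P then a else 0) + if P then b else 0 := by intros; split_ifs <;> simp
    simp only [map_add, h, h', mass_add, Finsupp.add_apply, h1, Finset.sum_add_distrib]
    ring
  | single p n =>
    simp only [Finsupp.linearCombination_single, edgePart_single, leafPart_single]
    rcases p with (⟨w⟩ | ⟨e, t, h₀, h₁⟩ | ⟨l, t, h₀⟩) | ⟨l⟩
    · simp [edgeCoord, leafCoord, mass_zero, baseIndicator_vertex, Finsupp.single_apply]
    · rw [Finset.sum_eq_single e (fun b _ hb => by simp [edgeCoord, hb.symm, mass_zero]) (by simp)]
      simp [edgeCoord, leafCoord, mass_zero, mass_single, baseIndicator_edge]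
    · rw [Finset.sum_eq_single (M := ℤ) l
        (fun b _ hb => by simp [leafCoord, hb.symm, mass_zero]) (by simp)]
      simp [edgeCoord, leafCoord, mass_zero, mass_single, baseIndicator_leaf]
    · rw [Finset.sum_eq_single (M := ℤ) l
        (fun b _ hb => by simp [leafCoord, hb.symm, mass_zero]) (by simp)]
      simp [edgeCoord, leafCoord, mass_zero, baseIndicator_infty]

/-! ### Principal divisors -/

/-! ### Slopes of a rational function in terms of its divisor -/

section RationalFunction

variable {f : G.FinPoint → ℝ} {D : G.Divisor}

/-- On an edge, a rational function is determined by its divisor and its boundary values, up to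
its initial slope `m`. -/
theorem exists_edge_slope (hf : RationalOn f Set.univ) (hD : ∀ p, ord f p = D p) (e : G.E) :
    ∃ m : ℤ, f (.vertex (G.tgt e)) - f (.vertex (G.src e)) =
        (m + mass (edgePart e D) : ℤ) * G.len e - moment (edgePart e D) ∧
      slope f (.fin (.vertex (G.src e))) (.inl (e, true)) = m ∧
      slope f (.fin (.vertex (G.tgt e))) (.inl (e, false)) = -(m + mass (edgePart e D)) := by
  have hl := G.len_pos e
  obtain ⟨c, m, hc⟩ := exists_eq_add_kink (F := fun t => f (edgePt e t)) (a := edgePart e D)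
    (isOpen_Ioo (a := 0) (b := G.len e)) isPreconnected_Ioo (Set.nonempty_Ioo.2 hl) fun t ht => by
      have hp := edgePt_of_mem ht.1 ht.2
      obtain ⟨r, hr⟩ := hf (.fin (.edge e t ht.1 ht.2)) trivial (.inl (e, true))
        (mem_tangents.2 rfl)
      obtain ⟨l, hl⟩ := hf (.fin (.edge e t ht.1 ht.2)) trivial (.inl (e, false))
        (mem_tangents.2 rfl)
      refine ⟨r, l, ?_, ?_⟩
      · rw [HasSlopes, hp]
        exact ⟨hr, hl⟩
      · rw [edgePart_apply, dif_pos (show 0 < t ∧ t < G.len e from ht), ← hD, ord, sum_tangents_edge, hr.slope_eq, hl.slope_eq]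
  obtain ⟨r, hr⟩ := hf (.fin (.vertex (G.src e))) trivial (.inl (e, true)) (mem_tangents.2 rfl)
  obtain ⟨l, hl'⟩ := hf (.fin (.vertex (G.tgt e))) trivial (.inl (e, false)) (mem_tangents.2 rfl)
  -- `HasSlope` at a vertex refers to the value there, so comparing affine germs gives continuity
  -- along with the slope. Near the source no bend has occurred yet; near the target all of them
  -- have.
  have h1 : c = f (.vertex (G.src e)) ∧ (m : ℝ) = r := by
    refine affine_eq_of_eventually ?_
    filter_upwards [hr, eventually_pos_lt hl, eventually_kink_eq_zero (a := edgePart e D)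
      fun u hu => (mem_support_edgePart hu).1] with s e1 e2 e3
    rw [← e1]
    refine Eq.trans ?_ (hc s e2).symm
    rw [e3, add_zero]
  have h2 : c + m * G.len e + mass (edgePart e D) * G.len e - moment (edgePart e D) =
      f (.vertex (G.tgt e)) ∧ (-(m + mass (edgePart e D)) : ℝ) = l := by
    refine affine_eq_of_eventually ?_
    filter_upwards [hl', eventually_pos_lt hl, eventually_kink_sub_eq (a := edgePart e D)
      fun u hu => (mem_support_edgePart hu).2] with s e1 e2 e3
    rw [← e1]
    refine Eq.trans ?_ (hc (G.len e - s) ⟨by linarith [e2.2], by linarith [e2.1]⟩).symm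
    rw [e3]; ring
  refine ⟨m, ?_, ?_, ?_⟩
  · rw [← h2.1, ← h1.1]; push_cast; ring
  · rw [hr.slope_eq]; exact_mod_cast h1.2.symm
  · rw [hl'.slope_eq]; exact_mod_cast h2.2.symm

/-- The initial slope of a rational function on a leaf is determined by its divisor. -/
theorem leaf_slope (hf : RationalOn f Set.univ) (hD : ∀ p, ord f p = D p) (l : G.L) :
    slope f (.fin (.vertex (G.root l))) (.inr (l, true)) =
      -(mass (leafPart l D) + D (.infty l)) := by
  obtain ⟨c, m, hc⟩ := exists_eq_add_kink (F := fun t => f (leafPt l t)) (a := leafPart l D)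
    (isOpen_Ioi (a := (0 : ℝ))) isPreconnected_Ioi Set.nonempty_Ioi fun t ht => by
      have hp := leafPt_of_pos (l := l) ht
      obtain ⟨r, hr⟩ := hf (.fin (.leaf l t ht)) trivial (.inr (l, true)) (mem_tangents.2 rfl)
      obtain ⟨r', hr'⟩ := hf (.fin (.leaf l t ht)) trivial (.inr (l, false)) (mem_tangents.2 rfl)
      refine ⟨r, r', ?_, ?_⟩
      · rw [HasSlopes, hp]
        exact ⟨hr, hr'⟩
      · rw [leafPart_apply, dif_pos (show 0 < t from ht), ← hD, ord, sum_tangents_leaf, hr.slope_eq, hr'.slope_eq]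
  obtain ⟨r, hr⟩ := hf (.fin (.vertex (G.root l))) trivial (.inr (l, true)) (mem_tangents.2 rfl)
  have h1 : c = f (.vertex (G.root l)) ∧ (m : ℝ) = r := by
    refine affine_eq_of_eventually ?_
    filter_upwards [hr, eventually_pos_lt one_pos, eventually_kink_eq_zero (a := leafPart l D)
      fun u hu => mem_support_leafPart hu] with s e1 e2 e3
    rw [← e1]
    refine Eq.trans ?_ (hc s e2.1).symm
    rw [e3, add_zero]
  -- Past all bends the slope towards infinity is `m + mass`, and the only tangent vector at the
  -- endpoint points the other way; hence `D (.infty l)` fixes `m`.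
  have h2 : HasSlope f (.infty l) (.inr (l, false)) (-(m + mass (leafPart l D))) := by
    refine ⟨c - moment (leafPart l D), ?_⟩
    filter_upwards [eventually_gt_atTop 0, eventually_atTop_kink_eq (leafPart l D)] with t e1 e2
    refine (hc t e1).trans ?_
    rw [e2]; push_cast; ring
  have h3 := hD (.infty l)
  rw [ord, sum_tangents_infty, h2.slope_eq] at h3
  have h4 : m = r := by exact_mod_cast h1.2
  rw [hr.slope_eq, ← h3, ← h4]; ring

end RationalFunction

/-- The piecewise affine function with values `φ` at the vertices, initial slopes `m` on the edges
and `n` on the leaves, and bends `D`. -/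
noncomputable def bendFunction (φ : G.V → ℝ) (m : G.E → ℤ) (n : G.L → ℤ) (D : G.Divisor) :
    G.FinPoint → ℝ
  | .vertex v => φ v
  | .edge e t _ _ => φ (G.src e) + m e * t + kink (edgePart e D) t
  | .leaf l t _ => φ (G.root l) + n l * t + kink (leafPart l D) t

/-! ### Construction of rational functions with prescribed bends -/

section BendFunction

variable (φ : G.V → ℝ) (m : G.E → ℤ) (n : G.L → ℤ) (D : G.Divisor)

theorem bendFunction_edgePt {e : G.E} {t : ℝ} (h₀ : 0 < t) (h₁ : t < G.len e) :
    bendFunction φ m n D (edgePt e t) = φ (G.src e) + m e * t + kink (edgePart e D) t := by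
  rw [edgePt_of_mem h₀ h₁]; rfl

theorem bendFunction_leafPt {l : G.L} {t : ℝ} (h₀ : 0 < t) :
    bendFunction φ m n D (leafPt l t) = φ (G.root l) + n l * t + kink (leafPart l D) t := by
  rw [leafPt_of_pos h₀]; rfl

theorem bendFunction_edge (e : G.E) (t : ℝ) (h₀ : 0 < t) (h₁ : t < G.len e) :
    RationalOn (bendFunction φ m n D) {.fin (.edge e t h₀ h₁)} ∧
      ord (bendFunction φ m n D) (.fin (.edge e t h₀ h₁)) = D (.fin (.edge e t h₀ h₁)) := by
  classical
  obtain ⟨r, l, h, hrl⟩ := exists_hasSlopes_add_kink (φ (G.src e)) (m e) (edgePart e D) t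
  have h1 : HasSlope (bendFunction φ m n D) (.fin (.edge e t h₀ h₁)) (.inl (e, true)) r := by
    filter_upwards [h.1, eventually_pos_lt (sub_pos.2 h₁)] with s e1 e2
    exact (bendFunction_edgePt φ m n D (by linarith) (by linarith)).trans e1
  have h2 : HasSlope (bendFunction φ m n D) (.fin (.edge e t h₀ h₁)) (.inl (e, false)) l := by
    filter_upwards [h.2, eventually_pos_lt h₀] with s e1 e2
    exact (bendFunction_edgePt φ m n D (by linarith) (by linarith)).trans e1
  refine ⟨?_, ?_⟩
  · rintro _ rfl τ hτ
    simp only [tangents_edge, Finset.mem_insert, Finset.mem_singleton] at hτ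
    rcases hτ with rfl | rfl
    exacts [⟨r, h1⟩, ⟨l, h2⟩]
  · rw [ord, sum_tangents_edge, h1.slope_eq, h2.slope_eq, hrl, edgePart_apply, dif_pos ⟨h₀, h₁⟩]

theorem bendFunction_leaf (l : G.L) (t : ℝ) (h₀ : 0 < t) :
    RationalOn (bendFunction φ m n D) {.fin (.leaf l t h₀)} ∧
      ord (bendFunction φ m n D) (.fin (.leaf l t h₀)) = D (.fin (.leaf l t h₀)) := by
  classical
  obtain ⟨r, r', h, hrr⟩ := exists_hasSlopes_add_kink (φ (G.root l)) (n l) (leafPart l D) t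
  have h1 : HasSlope (bendFunction φ m n D) (.fin (.leaf l t h₀)) (.inr (l, true)) r := by
    filter_upwards [h.1, eventually_pos_lt one_pos] with s e1 e2
    exact (bendFunction_leafPt φ m n D (by linarith)).trans e1
  have h2 : HasSlope (bendFunction φ m n D) (.fin (.leaf l t h₀)) (.inr (l, false)) r' := by
    filter_upwards [h.2, eventually_pos_lt h₀] with s e1 e2
    exact (bendFunction_leafPt φ m n D (by linarith)).trans e1
  refine ⟨?_, ?_⟩
  · rintro _ rfl τ hτ
    simp only [tangents_leaf, Finset.mem_insert, Finset.mem_singleton] at hτ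
    rcases hτ with rfl | rfl
    exacts [⟨r, h1⟩, ⟨r', h2⟩]
  · rw [ord, sum_tangents_leaf, h1.slope_eq, h2.slope_eq, hrr, leafPart_apply, dif_pos h₀]

theorem bendFunction_hasSlope_infty (l : G.L) :
    HasSlope (bendFunction φ m n D) (.infty l) (.inr (l, false))
      (-(n l + mass (leafPart l D))) := by
  refine ⟨φ (G.root l) - moment (leafPart l D), ?_⟩
  filter_upwards [eventually_gt_atTop 0, eventually_atTop_kink_eq (leafPart l D)] with t e1 e2
  rw [bendFunction_leafPt φ m n D e1, e2]; push_cast; ring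

theorem bendFunction_hasSlope_src (e : G.E) :
    HasSlope (bendFunction φ m n D) (.fin (.vertex (G.src e))) (.inl (e, true)) (m e) := by
  filter_upwards [eventually_pos_lt (G.len_pos e), eventually_kink_eq_zero (a := edgePart e D)
    fun u hu => (mem_support_edgePart hu).1] with s e1 e2
  exact (bendFunction_edgePt φ m n D e1.1 e1.2).trans (by rw [e2, add_zero]; rfl)

theorem bendFunction_hasSlope_root (l : G.L) :
    HasSlope (bendFunction φ m n D) (.fin (.vertex (G.root l))) (.inr (l, true)) (n l) := by
  filter_upwards [eventually_pos_lt one_pos, eventually_kink_eq_zero (a := leafPart l D)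
    fun u hu => mem_support_leafPart hu] with s e1 e2
  exact (bendFunction_leafPt φ m n D e1.1).trans (by rw [e2, add_zero]; rfl)

/-- The hypothesis is continuity at the far end: the formula on the edge must arrive at the
prescribed value at `tgt e`. The near ends match by construction. -/
theorem bendFunction_hasSlope_tgt (e : G.E) (h : φ (G.tgt e) - φ (G.src e) =
      (m e + mass (edgePart e D) : ℤ) * G.len e - moment (edgePart e D)) :
    HasSlope (bendFunction φ m n D) (.fin (.vertex (G.tgt e))) (.inl (e, false))
      (-(m e + mass (edgePart e D))) := by
  filter_upwards [eventually_pos_lt (G.len_pos e), eventually_kink_sub_eq (a := edgePart e D)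
    fun u hu => (mem_support_edgePart hu).2] with s e1 e2
  refine (bendFunction_edgePt φ m n D (by linarith [e1.2]) (by linarith [e1.1])).trans ?_
  rw [e2]
  show _ = φ (G.tgt e) + _
  push_cast at h ⊢
  linarith

end BendFunction

open Classical in
/-- A divisor is principal if and only if there are vertex values and initial slopes on the edges
compatible with it. -/
theorem isPrincipal_iff (D : G.Divisor) : IsPrincipal D ↔ ∃ (φ : G.V → ℝ) (m : G.E → ℤ),
    (∀ e, φ (G.tgt e) - φ (G.src e) =
      (m e + mass (edgePart e D) : ℤ) * G.len e - moment (edgePart e D)) ∧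
    ∀ v, D (.fin (.vertex v)) = ∑ e, ((if G.src e = v then m e else 0) +
        if G.tgt e = v then -(m e + mass (edgePart e D)) else 0) +
      ∑ l, if G.root l = v then -(mass (leafPart l D) + D (.infty l)) else 0 := by
  constructor
  · rintro ⟨f, hf, hD⟩
    choose m h1 h2 h3 using exists_edge_slope hf hD
    refine ⟨fun v => f (.vertex v), m, h1, fun v => ?_⟩
    rw [← hD, ord, sum_tangents_vertex]
    congr 1
    · refine Finset.sum_congr rfl fun e _ => ?_
      congr 1
      · split_ifs with h
        · rw [← h, h2]
        · rfl
      · split_ifs with h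
        · rw [← h, h3]
        · rfl
    · refine Finset.sum_congr rfl fun l _ => ?_
      split_ifs with h
      · rw [← h, leaf_slope hf hD]
      · rfl
  · rintro ⟨φ, m, h1, h2⟩
    -- The only initial slope on the leaf for which the order at its endpoint is `D (.infty l)`.
    set n : G.L → ℤ := fun l => -(mass (leafPart l D) + D (.infty l)) with hn
    have hs := bendFunction_hasSlope_src φ m n D
    have ht := fun e => bendFunction_hasSlope_tgt φ m n D e (h1 e)
    have hr := bendFunction_hasSlope_root φ m n D
    have hi := bendFunction_hasSlope_infty φ m n D
    refine ⟨bendFunction φ m n D, RationalOn.of_local ?_, ?_⟩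
    · rintro ((⟨v⟩ | ⟨e, t, h₀, h₁⟩ | ⟨l, t, h₀⟩) | ⟨l⟩) -
      · rintro _ rfl (⟨e, _ | _⟩ | ⟨l, _ | _⟩) hτ
        · obtain rfl : G.tgt e = v := mem_tangents.1 hτ
          exact ⟨_, ht e⟩
        · obtain rfl : G.src e = v := mem_tangents.1 hτ
          exact ⟨_, hs e⟩
        · exact absurd (mem_tangents.1 hτ) id
        · obtain rfl : G.root l = v := mem_tangents.1 hτ
          exact ⟨_, hr l⟩
      · exact (bendFunction_edge φ m n D e t h₀ h₁).1
      · exact (bendFunction_leaf φ m n D l t h₀).1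
      · rintro _ rfl τ hτ
        rw [tangents_infty, Finset.mem_singleton] at hτ
        subst hτ
        exact ⟨_, hi l⟩
    · rintro ((⟨v⟩ | ⟨e, t, h₀, h₁⟩ | ⟨l, t, h₀⟩) | ⟨l⟩)
      · rw [h2, ord, sum_tangents_vertex]
        congr 1
        · refine Finset.sum_congr rfl fun e _ => ?_
          congr 1
          · split_ifs with h
            · rw [← h, (hs e).slope_eq]
            · rfl
          · split_ifs with h
            · rw [← h, (ht e).slope_eq]
            · rfl
        · refine Finset.sum_congr rfl fun l _ => ?_
          split_ifs with h
          · rw [← h, (hr l).slope_eq]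
          · rfl
      · exact (bendFunction_edge φ m n D e t h₀ h₁).2
      · exact (bendFunction_leaf φ m n D l t h₀).2
      · rw [ord, sum_tangents_infty, (hi l).slope_eq, hn]; ring

/-- **Tropical Abel theorem**: a divisor of degree zero is principal if and only if its integral
is a period. -/
theorem isPrincipal_iff_integralAlong_mem {p₀ : G.Point} (γ : ∀ p, Path p₀ p) {D : G.Divisor}
    (hD : D.deg = 0) : IsPrincipal D ↔ integralAlong γ D ∈ G.period.range := by
  classical
  obtain ⟨N, h1, h2⟩ := exists_integralAlong_eq γ D
  simp only [hD, zero_smul, zero_mul, sub_zero, linearCombination_offset,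
    linearCombination_baseIndicator] at h1 h2
  have hchain : ∀ n : G.E → ℤ, chainIntegral n =
      ∑ e, ((n e : ℝ) * G.len e) • Form.eval (G := G) (.inl (e, true)) := fun n => by
    simp only [chainIntegral, mul_smul, Int.cast_smul_eq_zsmul]
  -- Closedness of `N + m + mass` at `v` is exactly the vertex condition of `isPrincipal_iff`. The
  -- boundary of `N` collects the points with base vertex `v`, which supplies the edge masses and
  -- leaf terms.
  have hbd : ∀ (m : G.E → ℤ) v,
      edgeBoundary (fun e => N e + m e + mass (edgePart e D)) v = D (.fin (.vertex v)) -
        (∑ e, ((if G.src e = v then m e else 0) +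
          if G.tgt e = v then -(m e + mass (edgePart e D)) else 0) +
        ∑ l, if G.root l = v then -(mass (leafPart l D) + D (.infty l)) else 0) := by
    intro m v
    have e1 : edgeBoundary (fun e => N e + m e + mass (edgePart e D)) v =
        edgeBoundary N v + edgeBoundary (fun e => m e + mass (edgePart e D)) v := by
      rw [← edgeBoundary_add]
      congr 1
      funext e
      simp only [Pi.add_apply]; ring
    have e2 : ∑ l, (if G.root l = v then -(mass (leafPart l D) + D (.infty l)) else 0) =
        - ∑ l, if G.root l = v then mass (leafPart l D) + D (.infty l) else 0 := by
      rw [← Finset.sum_neg_distrib]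
      refine Finset.sum_congr rfl fun l _ => ?_
      split_ifs <;> simp
    have e3 : edgeBoundary (fun e => m e + mass (edgePart e D)) v +
        ∑ e, (if G.src e = v then mass (edgePart e D) else 0) =
        - ∑ e, ((if G.src e = v then m e else 0) +
          if G.tgt e = v then -(m e + mass (edgePart e D)) else 0) := by
      rw [edgeBoundary, ← Finset.sum_neg_distrib, ← Finset.sum_add_distrib]
      refine Finset.sum_congr rfl fun e _ => ?_
      by_cases ha : G.tgt e = v <;> by_cases hb : G.src e = v <;> simp [ha, hb]
    rw [e1, h2, e2]
    linarith
  rw [isPrincipal_iff, mem_range_period_iff]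
  -- The coefficients on the right are the increments of the edge condition in `isPrincipal_iff`; by
  -- duality the difference vanishes if and only if they come from vertex values.
  have hcomb : ∀ m : G.E → ℤ,
      chainIntegral (fun e => N e + m e + mass (edgePart e D)) - integralAlong γ D =
      ∑ e, ((m e + mass (edgePart e D) : ℤ) * G.len e - moment (edgePart e D)) •
        Form.eval (G := G) (.inl (e, true)) := by
    intro m
    rw [h1, hchain, hchain, ← Finset.sum_add_distrib, ← Finset.sum_sub_distrib]
    refine Finset.sum_congr rfl fun e _ => ?_
    push_cast
    module
  constructor
  · rintro ⟨φ, m, h3, h4⟩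
    refine ⟨fun e => N e + m e + mass (edgePart e D), fun v => ?_, ?_⟩
    · rw [hbd, ← h4, sub_self]
    · rw [← sub_eq_zero, hcomb, sum_smul_eval_eq_zero_iff]
      exact ⟨φ, fun e => (h3 e).symm⟩
  · rintro ⟨n, h3, h4⟩
    -- Conversely, a closed chain `n` representing the period dictates the initial slopes `n - N -
    -- mass`, and duality supplies the vertex values.
    have hn : (fun e => N e + (n e - N e - mass (edgePart e D)) + mass (edgePart e D)) = n := by
      funext e; ring
    have h5 := hcomb fun e => n e - N e - mass (edgePart e D)
    rw [hn, h4, sub_self, eq_comm, sum_smul_eval_eq_zero_iff] at h5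
    obtain ⟨φ, hφ⟩ := h5
    refine ⟨φ, fun e => n e - N e - mass (edgePart e D), fun e => (hφ e).symm, fun v => ?_⟩
    have h6 := hbd (fun e => n e - N e - mass (edgePart e D)) v
    rw [hn, h3] at h6
    exact sub_eq_zero.1 h6.symm

/-! ### The Abel-Jacobi map -/

theorem integralAlong_add {p₀ : G.Point} (γ : ∀ p, Path p₀ p) (D D' : G.Divisor) :
    integralAlong γ (D + D') = integralAlong γ D + integralAlong γ D' := by
  simp only [integralAlong_eq, map_add]

theorem Divisor.deg_add (D D' : G.Divisor) :
    Divisor.deg (D + D') = Divisor.deg D + Divisor.deg D' := by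
  simp only [Divisor.deg_eq, map_add]

/-- Every functional on forms is, up to periods, the integral of a divisor of degree zero. -/
theorem exists_integralAlong_sub_mem {p₀ : G.Point} (γ : ∀ p, Path p₀ p)
    (u : Module.Dual ℝ G.Form) :
    ∃ D : G.Divisor, D.deg = 0 ∧ integralAlong γ D - u ∈ G.period.range := by
  obtain ⟨a, rfl⟩ := exists_eq_sum_smul_eval u
  have hedge : ∀ e, ∃ D : G.Divisor, D.deg = 0 ∧
      integralAlong γ D - a e • Form.eval (.inl (e, true)) ∈ G.period.range := by
    intro e
    have hl := G.len_pos e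
    -- With this `k`, a segment of length `|a e| / k` fits into the edge; it is placed symmetrically
    -- about the midpoint, and its ends taken with multiplicities `k` and `-k` give the divisor.
    obtain ⟨k, hk⟩ := exists_int_gt (|a e| / G.len e)
    have hk0 : (0 : ℝ) < k := lt_of_le_of_lt (by positivity) hk
    rw [div_lt_iff₀ hl] at hk
    obtain ⟨x, y, hx, hy, hxy⟩ : ∃ x y : ℝ, x ∈ Set.Icc 0 (G.len e) ∧ y ∈ Set.Icc 0 (G.len e) ∧
        a e = k * (y - x) := by
      have hs : a e = k * (a e / k) := by field_simp
      have hs' : |a e / k| < G.len e := by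
        rwa [abs_div, abs_of_pos hk0, div_lt_iff₀ hk0, mul_comm]
      obtain ⟨hs1, hs2⟩ := abs_lt.1 hs'
      refine ⟨G.len e / 2 - a e / k / 2, G.len e / 2 + a e / k / 2, ⟨by linarith, by linarith⟩,
        ⟨by linarith, by linarith⟩, hs.trans ?_⟩
      congr 1
      ring
    refine ⟨Finsupp.single (.fin (edgePt e y)) k - Finsupp.single (.fin (edgePt e x)) k, ?_, ?_⟩
    · simp [Divisor.deg_eq]
    -- The path to `y` and the path to `x` followed by the segment from `x` to `y` have the same
    -- ends, so their integrals differ by a period.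
    · have h := zsmul_mem ((γ (.fin (edgePt e y))).integral_sub_mem
        ((γ (.fin (edgePt e x))).trans (.edge e x y hx hy))) k
      convert h using 1
      rw [integralAlong_eq, map_sub, Finsupp.linearCombination_single,
        Finsupp.linearCombination_single, hxy, mul_smul, Int.cast_smul_eq_zsmul]
      simp only [Path.integral]
      module
  choose D h1 h2 using hedge
  refine ⟨∑ e, D e, ?_, ?_⟩
  · simp only [Divisor.deg_eq, map_sum] at h1 ⊢
    exact Finset.sum_eq_zero fun e _ => h1 e
  · rw [integralAlong_eq, map_sum, ← Finset.sum_sub_distrib]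
    exact sum_mem fun e _ => h2 e

/-- By linearity of integration this is Abel's theorem for the difference, which has degree zero. -/
theorem abelJacobi_eq_iff (p₀ : G.Point) {d : ℤ} (D D' : G.DivDeg d) :
    abelJacobi p₀ D = abelJacobi p₀ D' ↔ IsPrincipal (D.1 - D'.1) := by
  have hdeg : Divisor.deg (D.1 - D'.1) = 0 := by
    have h1 := D.2
    have h2 := D'.2
    rw [Divisor.deg_eq] at h1 h2 ⊢
    rw [map_sub, h1, h2, sub_self]
  rw [isPrincipal_iff_integralAlong_mem (fun p => (nonempty_path p₀ p).some) hdeg, eq_comm,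
    abelJacobi, abelJacobi, QuotientAddGroup.eq, neg_add_eq_sub]
  simp only [integralAlong_eq, map_sub]

theorem abelJacobi_surjective (p₀ : G.Point) (d : ℤ) :
    Function.Surjective (abelJacobi p₀ : G.DivDeg d → G.Jacobian) := by
  intro x
  obtain ⟨u, rfl⟩ := QuotientAddGroup.mk_surjective x
  set γ := fun p => (nonempty_path p₀ p).some
  -- The multiple `d` of `p₀` supplies the degree. Its integral is subtracted because the chosen
  -- path from `p₀` to itself may be a nontrivial loop.
  obtain ⟨D, h1, h2⟩ :=
    exists_integralAlong_sub_mem γ (u - integralAlong γ (Finsupp.single p₀ d))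
  refine ⟨⟨D + Finsupp.single p₀ d, ?_⟩, ?_⟩
  · rw [Divisor.deg_add, h1, zero_add, Divisor.deg_eq]; simp
  · refine Eq.symm (QuotientAddGroup.eq.2 ?_)
    rw [integralAlong_add, neg_add_eq_sub]
    convert h2 using 1
    abel

end TropicalCurve

/-! ### The tropical Abel–Jacobi theorem -/

theorem mainTheorem1 (C : TropicalCurve.{u}) (p₀ : C.Point) (d : ℤ) :
    (∀ (γ : ∀ p, TropicalCurve.Path p₀ p) (D : C.DivDeg d),
      TropicalCurve.abelJacobi p₀ D =
        (QuotientAddGroup.mk (TropicalCurve.integralAlong γ D.1) : C.Jacobian)) ∧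
    ∃ φ : C.PicDeg d → C.Jacobian,
      (∀ D : C.DivDeg d,
        TropicalCurve.abelJacobi p₀ D = φ (TropicalCurve.PicDeg.ofDivisor D)) ∧
      Function.Bijective φ := by
  refine ⟨fun γ D => TropicalCurve.mk_integralAlong_eq _ γ D.1, ?_⟩
  have hiff : ∀ D D' : C.DivDeg d, TropicalCurve.PicDeg.ofDivisor D =
      TropicalCurve.PicDeg.ofDivisor D' ↔
      TropicalCurve.abelJacobi p₀ D = TropicalCurve.abelJacobi p₀ D' := fun D D' => by
    rw [TropicalCurve.PicDeg.ofDivisor_eq_iff, TropicalCurve.abelJacobi_eq_iff]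
  have hsurj := TropicalCurve.PicDeg.ofDivisor_surjective (G := C) d
  have hφ : ∀ D : C.DivDeg d, TropicalCurve.abelJacobi p₀ D = TropicalCurve.abelJacobi p₀
      (Function.surjInv hsurj (TropicalCurve.PicDeg.ofDivisor D)) := fun D =>
    (hiff _ _).1 (Function.surjInv_eq hsurj _).symm
  -- Since the two surjections have the same fibres, composing μ with any section of D ↦ [L(D)]
  -- gives the factorization. One direction of `hiff` makes it compatible with μ, the other makes it
  -- injective.
  refine ⟨fun c => TropicalCurve.abelJacobi p₀ (Function.surjInv hsurj c), hφ, ?_, ?_⟩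
  · intro c c' h
    rw [← Function.surjInv_eq hsurj c, ← Function.surjInv_eq hsurj c']
    exact (hiff _ _).2 h
  · intro x
    obtain ⟨D, rfl⟩ := TropicalCurve.abelJacobi_surjective p₀ d x
    exact ⟨TropicalCurve.PicDeg.ofDivisor D, (hφ D).symm⟩
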